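/- Let $n\in\mathbb N$, $n\ge 3$. For $\gamma\ge 0$ let $\Lambda_{\gamma,n}=-\Delta_{\mathbb S^{n-1}}+\gamma\cos(\theta_{n-1})$ be the self-adjoint operator in $L^2(\mathbb S^{n-1})$ given by the closure of its restriction to $C^\infty(\mathbb S^{n-1})$, where $\Delta_{\mathbb S^{n-1}}$ is the Laplace--Beltrami operator and $\cos(\theta_{n-1})=x_n$ is the last Cartesian coordinate on $\mathbb S^{n-1}\subset\mathbb R^n$. Let $\lambda_{\gamma,n,0}$ be its lowest eigenvalue, and let $\gamma_{c,n}>0$ be the critical dipole moment, i.e. the unique $\gamma>0$ with $\lambda_{\gamma,n,0}=-(n-2)^2/4$. Put $$a_\ell=\Big[\frac{\ell(\ell+n-3)}{(2\ell+n-4)(2\ell+n-2)}\Big]^{1/2}\ (\ell\in\mathbb N),\quad a_0=0,\qquad w_\ell(\gamma)=\ell(\ell+n-2)-\lambda_{\gamma,n,0}\ (\ell\in\mathbb N_0),$$ $$\widetilde a_\ell(\gamma)=w_\ell(\gamma)^{-1/2}\,a_\ell\,w_{\ell-1}(\gamma)^{-1/2}\ (\ell\in\mathbb N),\qquad \widetilde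 a_0(\gamma)=0.$$ Let $J$ be the Jacobi operator in $\ell^2(\mathbb N_0)$ with zero diagonal and off-diagonal entries $a_1,a_2,\dots$, that is, $(Jd)_0=a_1d_1$ and $(Jd)_\ell=a_{\ell+1}d_{\ell+1}+a_\ell d_{\ell-1}$ for $\ell\ge1$; let $w(\gamma)$ be multiplication by $(w_\ell(\gamma))_{\ell\in\mathbb N_0}$, and let $K(\gamma)=w(\gamma)^{-1/2}Jw(\gamma)^{-1/2}\in\mathcal B(\ell^2(\mathbb N_0))$ for $\gamma\in(0,\gamma_{c,n}]$. Then, for every $\gamma\in(0,\gamma_{c,n}]$, the operator $K(\gamma)$ is compact and $$\gamma K(\gamma)\ge -I_{\ell^2(\mathbb N_0)} .$$ Moreover, $$\|K(\gamma_{c,n})\|_{\mathcal B(\ell^2(\mathbb N_0))}\le\begin{cases}8/3^{3/2},& n=3,\\ 2\,\widetilde a_1(\gamma_{c,4}),& n=4,\\ 2\max\{\widetilde a_{\ell_{r,n}}(\gamma_{c,n}),\widetilde a_{\ell_{r,n}-1}(\gamma_{c,n})\},& n\ge5,\end{cases}$$ where $$r(n)=\tfrac14\Big(6-2n+\big\{2[26-18n+3n^2]\big\}^{1/2}\Big),\qquad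 \ell_{r,n}=\lceil r(n)\rceil=\inf\{m\in\mathbb N_0\,|\,m\ge r(n)\}.$$ -/

import Mathlib

open MeasureTheory
open scoped ContDiff Laplacian

noncomputable section

namespace Dipole

/-! ### The angular operator on the unit sphere -/

/-- The unit sphere `S^{n-1}` in `ℝⁿ`. -/
abbrev Sph (n : ℕ) : Type := Metric.sphere (0 : EuclideanSpace ℝ (Fin n)) 1

/-- The surface measure on `S^{n-1}`. -/
abbrev surfaceMeasure (n : ℕ) : Measure (Sph n) :=
  (volume : Measure (EuclideanSpace ℝ (Fin n))).toSphere

/-- The extension `y ↦ f (y / |y|)` of a function on the sphere to `ℝⁿ \ {0}`, homogeneous of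
degree zero (the value at the origin is irrelevant). -/
def radialExtension {n : ℕ} (f : Sph n → ℂ) (y : EuclideanSpace ℝ (Fin n)) : ℂ :=
  if hy : y = 0 then 0
  else f ⟨‖y‖⁻¹ • y, by simp [norm_smul, inv_mul_cancel₀ (norm_ne_zero_iff.mpr hy)]⟩

/-- `f ∈ C^∞(S^{n-1})`. -/
def IsSmoothOnSphere {n : ℕ} (f : Sph n → ℂ) : Prop :=
  ContDiffOn ℝ ∞ (radialExtension f) {0}ᶜ

/-- The Laplace–Beltrami differential expression on the sphere: the Euclidean Laplacian of the
extension that is constant along rays. -/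
def laplaceBeltrami {n : ℕ} (f : Sph n → ℂ) (x : Sph n) : ℂ :=
  Laplacian.laplacian (radialExtension f) (x : EuclideanSpace ℝ (Fin n))

/-- `cos θ_{n-1} = x_n`, the last Cartesian coordinate on the sphere. -/
def cosTheta {n : ℕ} (x : Sph n) : ℝ :=
  if h : 0 < n then (x : EuclideanSpace ℝ (Fin n)) ⟨n - 1, Nat.sub_lt h one_pos⟩ else 0

/-- The differential expression `-Δ_{S^{n-1}} + γ cos θ_{n-1}`. -/
def dipoleExpression {n : ℕ} (γ : ℝ) (f : Sph n → ℂ) (x : Sph n) : ℂ :=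
  -laplaceBeltrami f x + ((γ * cosTheta x : ℝ) : ℂ) * f x

/-- The graph, in `L²(S^{n-1}) × L²(S^{n-1})`, of `-Δ_{S^{n-1}} + γ cos θ_{n-1}` with domain
`C^∞(S^{n-1})`. -/
def smoothDipoleGraph (n : ℕ) (γ : ℝ) :
    Set (Lp ℂ 2 (surfaceMeasure n) × Lp ℂ 2 (surfaceMeasure n)) :=
  {p | ∃ φ : Sph n → ℂ, IsSmoothOnSphere φ ∧
    p.1 =ᵐ[surfaceMeasure n] φ ∧ p.2 =ᵐ[surfaceMeasure n] dipoleExpression γ φ}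

/-- The graph of the self-adjoint operator `Λ_{γ,n} = -Δ_{S^{n-1}} + γ cos θ_{n-1}` in
`L²(S^{n-1})`: the operator is essentially self-adjoint on `C^∞(S^{n-1})`, so that its
self-adjoint realization is the closure of the one above. -/
def dipoleGraph (n : ℕ) (γ : ℝ) :
    Set (Lp ℂ 2 (surfaceMeasure n) × Lp ℂ 2 (surfaceMeasure n)) :=
  closure (smoothDipoleGraph n γ)

/-- `μ` is an eigenvalue of `Λ_{γ,n}`. -/
def IsDipoleEigenvalue (n : ℕ) (γ μ : ℝ) : Prop :=
  ∃ f : Lp ℂ 2 (surfaceMeasure n), f ≠ 0 ∧ (f, (μ : ℂ) • f) ∈ dipoleGraph n γ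

/-- `λ_{γ,n,0}`, the lowest eigenvalue of `Λ_{γ,n}`. -/
def lowestEigenvalue (n : ℕ) (γ : ℝ) : ℝ :=
  sInf {μ : ℝ | IsDipoleEigenvalue n γ μ}

/-- The critical dipole moment `γ_{c,n}`: the (unique) `γ > 0` with
`λ_{γ,n,0} = -(n-2)²/4`. -/
def criticalMoment (n : ℕ) : ℝ :=
  sInf {γ : ℝ | 0 < γ ∧ lowestEigenvalue n γ = -((n : ℝ) - 2) ^ 2 / 4}

/-! ### The Jacobi coefficients -/

/-- `a_ℓ`. -/
def jacobiCoeff (n ℓ : ℕ) : ℝ :=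
  √(((ℓ : ℝ) * (ℓ + n - 3)) / ((2 * ℓ + n - 4) * (2 * ℓ + n - 2)))

/-- `w_ℓ(γ) = ℓ(ℓ+n-2) - λ_{γ,n,0}`; the index is a real number, so that `w_{ℓ-1}` makes sense
for every `ℓ`. -/
def weight (n : ℕ) (γ ℓ : ℝ) : ℝ :=
  ℓ * (ℓ + n - 2) - lowestEigenvalue n γ

/-- `ã_ℓ(γ) = w_ℓ(γ)^{-1/2} a_ℓ w_{ℓ-1}(γ)^{-1/2}`. -/
def jacobiCoeffTilde (n : ℕ) (γ : ℝ) (ℓ : ℕ) : ℝ :=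
  (√(weight n γ ℓ))⁻¹ * jacobiCoeff n ℓ * (√(weight n γ ((ℓ : ℝ) - 1)))⁻¹

/-- `r(n)`. -/
def rootR (n : ℕ) : ℝ :=
  (1 / 4) * (6 - 2 * (n : ℝ) + √(2 * (26 - 18 * (n : ℝ) + 3 * (n : ℝ) ^ 2)))

/-- `ℓ_{r,n} = ⌈r(n)⌉`, the least `m ∈ ℕ₀` with `m ≥ r(n)`. -/
def indexR (n : ℕ) : ℕ := ⌈rootR n⌉₊

/-! ### Operators on `ℓ²(ℕ₀)` -/

/-- The Hilbert space `ℓ²(ℕ₀)`. -/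
abbrev EllTwo : Type := lp (fun _ : ℕ => ℂ) 2

theorem summable_sq (x : EllTwo) : Summable fun ℓ => ‖x ℓ‖ ^ 2 := by
  have h := (memℓp_gen_iff (p := 2) (by norm_num)).1 (lp.memℓp x)
  simpa using h

theorem norm_sq_eq (x : EllTwo) : ‖x‖ ^ 2 = ∑' ℓ, ‖x ℓ‖ ^ 2 := by
  have h := lp.norm_rpow_eq_tsum (p := 2) (by norm_num) x
  simpa using h

theorem memlp_of_summable_sq {f : ℕ → ℂ} (h : Summable fun ℓ => ‖f ℓ‖ ^ 2) :
    Memℓp f 2 :=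
  (memℓp_gen_iff (p := 2) (by norm_num)).2 (by simpa using h)

theorem summable_diag {c : ℕ → ℝ} {C : ℝ} (hC : ∀ ℓ, |c ℓ| ≤ C) (x : EllTwo) :
    Summable fun ℓ => ‖(c ℓ : ℂ) * x ℓ‖ ^ 2 := by
  refine Summable.of_nonneg_of_le (fun _ => by positivity) (fun ℓ => ?_)
    ((summable_sq x).mul_left (C ^ 2))
  rw [norm_mul, mul_pow, Complex.norm_real, Real.norm_eq_abs]
  gcongr
  exact hC ℓ

/-- The diagonal operator `(x_ℓ) ↦ (c_ℓ x_ℓ)` for a bounded real sequence `c`. -/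
def diagOp (c : ℕ → ℝ) (hc : ∃ C, ∀ ℓ, |c ℓ| ≤ C) : EllTwo →L[ℂ] EllTwo :=
  LinearMap.mkContinuousOfExistsBound
    { toFun := fun x => ⟨fun ℓ => (c ℓ : ℂ) * x ℓ,
        memlp_of_summable_sq (summable_diag hc.choose_spec x)⟩
      map_add' := fun x y => by ext ℓ; exact mul_add (c ℓ : ℂ) (x ℓ) (y ℓ)
      map_smul' := fun z x => by ext ℓ; exact mul_left_comm (c ℓ : ℂ) z (x ℓ) } <| by
    obtain ⟨C, hC⟩ := hc
    have hC0 : 0 ≤ C := (abs_nonneg _).trans (hC 0)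
    refine ⟨C, fun x => ?_⟩
    refine le_of_sq_le_sq ?_ (by positivity)
    rw [norm_sq_eq, mul_pow, norm_sq_eq x, ← tsum_mul_left]
    refine Summable.tsum_le_tsum (fun ℓ => ?_) (summable_diag hC x)
      ((summable_sq x).mul_left (C ^ 2))
    change ‖(c ℓ : ℂ) * x ℓ‖ ^ 2 ≤ _
    rw [norm_mul, mul_pow, Complex.norm_real, Real.norm_eq_abs]
    gcongr
    exact hC ℓ

theorem diagOp_apply (c : ℕ → ℝ) (hc : ∃ C, ∀ ℓ, |c ℓ| ≤ C) (x : EllTwo) (ℓ : ℕ) :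
    diagOp c hc x ℓ = (c ℓ : ℂ) * x ℓ := rfl

/-- The left shift `(x_ℓ) ↦ (x_{ℓ+1})`. -/
def leftShift : EllTwo →L[ℂ] EllTwo :=
  LinearMap.mkContinuousOfExistsBound
    { toFun := fun x => ⟨fun ℓ => x (ℓ + 1),
        memlp_of_summable_sq ((summable_nat_add_iff 1).2 (summable_sq x))⟩
      map_add' := fun x y => by ext ℓ; rfl
      map_smul' := fun z x => by ext ℓ; rfl } <| by
    refine ⟨1, fun x => ?_⟩
    refine le_of_sq_le_sq ?_ (by positivity)
    rw [one_mul, norm_sq_eq, norm_sq_eq x, (summable_sq x).tsum_eq_zero_add]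
    change ∑' ℓ, ‖x (ℓ + 1)‖ ^ 2 ≤ _
    exact le_add_of_nonneg_left (by positivity)

theorem leftShift_apply (x : EllTwo) (ℓ : ℕ) : leftShift x ℓ = x (ℓ + 1) := rfl

/-- The sequence `(0, x_0, x_1, …)`. -/
def pad (x : ℕ → ℂ) : ℕ → ℂ
  | 0 => 0
  | ℓ + 1 => x ℓ

theorem summable_pad (x : EllTwo) : Summable fun ℓ => ‖pad x ℓ‖ ^ 2 :=
  (summable_nat_add_iff 1).1 (summable_sq x)

/-- The right shift `(x_ℓ) ↦ (0, x_0, x_1, …)`. -/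
def rightShift : EllTwo →L[ℂ] EllTwo :=
  LinearMap.mkContinuousOfExistsBound
    { toFun := fun x => ⟨pad x, memlp_of_summable_sq (summable_pad x)⟩
      map_add' := fun x y => by
        ext ℓ
        cases ℓ with
        | zero => exact (add_zero (0 : ℂ)).symm
        | succ ℓ => rfl
      map_smul' := fun z x => by
        ext ℓ
        cases ℓ with
        | zero => exact (mul_zero z).symm
        | succ ℓ => rfl } <| by
    refine ⟨1, fun x => ?_⟩
    refine le_of_sq_le_sq ?_ (by positivity)
    rw [one_mul, norm_sq_eq, norm_sq_eq x]
    change ∑' ℓ, ‖pad x ℓ‖ ^ 2 ≤ _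
    rw [(summable_pad x).tsum_eq_zero_add]
    simp [pad]

theorem rightShift_apply_zero (x : EllTwo) : rightShift x 0 = 0 := rfl

theorem rightShift_apply_succ (x : EllTwo) (ℓ : ℕ) : rightShift x (ℓ + 1) = x ℓ := rfl

theorem exists_bound_of_eventually {c : ℕ → ℝ} {C : ℝ}
    (h : ∀ᶠ ℓ in Filter.atTop, |c ℓ| ≤ C) : ∃ C, ∀ ℓ, |c ℓ| ≤ C := by
  have hb : Filter.IsBoundedUnder (· ≤ ·) Filter.atTop fun ℓ => |c ℓ| :=
    ⟨C, by simpa [Filter.eventually_map] using h⟩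
  obtain ⟨D, hD⟩ := hb.bddAbove_range
  exact ⟨D, fun ℓ => hD ⟨ℓ, rfl⟩⟩

theorem jacobiCoeff_bounded (n : ℕ) : ∃ C, ∀ ℓ, |jacobiCoeff n (ℓ + 1)| ≤ C := by
  refine exists_bound_of_eventually (C := 1) ?_
  filter_upwards [Filter.eventually_ge_atTop 4] with ℓ hℓ
  have h4 : (4 : ℝ) ≤ ℓ := by exact_mod_cast hℓ
  have hn : (0 : ℝ) ≤ n := n.cast_nonneg
  rw [jacobiCoeff, abs_of_nonneg (Real.sqrt_nonneg _)]
  refine Real.sqrt_le_iff.2 ⟨zero_le_one, ?_⟩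
  push_cast
  rw [one_pow]
  rw [div_le_one (by nlinarith)]
  nlinarith

theorem weight_bounded (n : ℕ) (γ : ℝ) : ∃ C, ∀ ℓ : ℕ, |(√(weight n γ ℓ))⁻¹| ≤ C := by
  refine exists_bound_of_eventually (C := 1) ?_
  obtain ⟨N, hN⟩ := exists_nat_ge (|lowestEigenvalue n γ| + 4)
  filter_upwards [Filter.eventually_ge_atTop N] with ℓ hℓ
  have h1 : (N : ℝ) ≤ ℓ := by exact_mod_cast hℓ
  have hn : (0 : ℝ) ≤ n := n.cast_nonneg
  have h2 := le_abs_self (lowestEigenvalue n γ)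
  have h3 := abs_nonneg (lowestEigenvalue n γ)
  rw [abs_of_nonneg (by positivity)]
  refine inv_le_one_of_one_le₀ (Real.one_le_sqrt.2 ?_)
  rw [weight]
  nlinarith

/-- The Jacobi operator `J` with vanishing diagonal and off-diagonal entries `a_1, a_2, …`. -/
def jacobiOp (n : ℕ) : EllTwo →L[ℂ] EllTwo :=
  diagOp (fun ℓ => jacobiCoeff n (ℓ + 1)) (jacobiCoeff_bounded n) ∘L leftShift +
    rightShift ∘L diagOp (fun ℓ => jacobiCoeff n (ℓ + 1)) (jacobiCoeff_bounded n)

theorem jacobiOp_apply_zero (n : ℕ) (d : EllTwo) :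
    jacobiOp n d 0 = (jacobiCoeff n 1 : ℂ) * d 1 :=
  add_zero _

theorem jacobiOp_apply_succ (n : ℕ) (d : EllTwo) (ℓ : ℕ) :
    jacobiOp n d (ℓ + 1) =
      (jacobiCoeff n (ℓ + 2) : ℂ) * d (ℓ + 2) + (jacobiCoeff n (ℓ + 1) : ℂ) * d ℓ :=
  rfl

/-- The diagonal operator `w(γ)^{-1/2}`. -/
def weightInvSqrt (n : ℕ) (γ : ℝ) : EllTwo →L[ℂ] EllTwo :=
  diagOp (fun ℓ => (√(weight n γ ℓ))⁻¹) (weight_bounded n γ)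

/-- `K(γ) = w(γ)^{-1/2} J w(γ)^{-1/2}`. -/
def weightedJacobi (n : ℕ) (γ : ℝ) : EllTwo →L[ℂ] EllTwo :=
  weightInvSqrt n γ ∘L jacobiOp n ∘L weightInvSqrt n γ

end Dipole

end

noncomputable section

namespace Dipole

/-! ### Calculus in Euclidean space -/

section Calculus

variable {E : Type*} [NormedAddCommGroup E] [InnerProductSpace ℝ E]

/-! The normalized zonal harmonics diagonalize `-Δ` with eigenvalues `ℓ(ℓ+n-2)`, and in this
orthonormal system multiplication by `cos θ` is exactly the Jacobi operator `J`
(`cosMul_zonalEmbedding`). The lowest eigenvalue `λ` minimizes the quadratic form of `Λ`, so on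
finite zonal combinations `∑ w_ℓ |d_ℓ|² + γ ⟨d, J d⟩ ≥ 0`. Substituting `d = w^{-1/2} x` turns this
into `‖x‖² + γ ⟨x, K x⟩ ≥ 0`, and density of the finite sequences gives `γ K ≥ -1`. Compactness
holds because `w_ℓ → ∞` makes `w^{-1/2}` a norm limit of finite-rank operators.

For the norm, `K = D L + R D` with `D` diagonal with entries `ã_{ℓ+1}` and `L`, `R` the contractive
shifts, so `‖K‖ ≤ 2 sup ã_ℓ` (`norm_weightedJacobi_le`). At the critical moment `w_ℓ` is a perfect
square and `ã_ℓ² = 16 u / (4 u + c)³` with `u = ℓ(ℓ+n-3)`, `c = (n-4)(n-2)`. For `c ≥ 0` this rises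
up to `u = c/8` and falls afterwards; `r(n)` is the larger root of `u = c/8`. For `n = 3` the
supremum is at `ℓ = 1` by a direct estimate.

Most of the work is to show that `lowestEigenvalue`, an infimum over eigenvalues of a closed graph,
really is the minimum of the form (`lowestEigenvalue_spec`). Green's identity on the sphere and
density of the spherical harmonics identify the graph closure through the compact resolvent `∑ (ν_k
+ c)⁻¹ P_k` (`mem_dipoleGraph_iff`); a Neumann series adds the bounded term `γ cos θ`, and the top
of a compact positive operator is an eigenvalue (`exists_ground_state`). The Lipschitz dependence of
`λ` on `γ` then shows that the critical moment is attained (`criticalMoment_spec`). -/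

theorem contDiffAt_fderiv_apply {F : E → ℂ} {x : E} {m k : WithTop ℕ∞} (hF : ContDiffAt ℝ k F x)
    (hmk : m + 1 ≤ k) (v : E) : ContDiffAt ℝ m (fun y => fderiv ℝ F y v) x :=
  (hF.fderiv_right hmk).clm_apply contDiffAt_const

theorem fderiv_mul_apply {F G : E → ℂ} {x : E} (hF : DifferentiableAt ℝ F x)
    (hG : DifferentiableAt ℝ G x) (v : E) :
    fderiv ℝ (fun y => F y * G y) x v = F x * fderiv ℝ G x v + G x * fderiv ℝ F x v := by
  rw [fderiv_fun_mul hF hG]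
  simp

theorem hasFDerivAt_radial {h : ℝ → ℝ} {h' : ℝ} {y : E} (hh : HasDerivAt h h' (‖y‖ ^ 2)) :
    HasFDerivAt (fun y : E => ((h (‖y‖ ^ 2) : ℝ) : ℂ))
      (Complex.ofRealCLM.comp ((2 * h') • innerSL ℝ y)) y := by
  have h1 : HasFDerivAt (fun y : E => ‖y‖ ^ 2) (2 • innerSL ℝ y) y :=
    (hasStrictFDerivAt_norm_sq y).hasFDerivAt
  have h2 := Complex.ofRealCLM.hasFDerivAt.comp y (hh.comp_hasFDerivAt y h1)
  refine h2.congr_fderiv ?_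
  ext v
  simp
  ring

theorem fderiv_radial_apply {h : ℝ → ℝ} {h' : ℝ} {y : E} (hh : HasDerivAt h h' (‖y‖ ^ 2)) (v : E) :
    fderiv ℝ (fun y : E => ((h (‖y‖ ^ 2) : ℝ) : ℂ)) y v = (2 * h' * inner ℝ y v : ℝ) := by
  rw [(hasFDerivAt_radial hh).fderiv]
  simp

variable {ι : Type*} [Fintype ι]

/-- The gradient of a radial factor points along `y`, so cross terms in product rules reduce to the
derivative along `y`, which vanishes for functions homogeneous of degree zero. -/
theorem sum_inner_mul_fderiv (b : OrthonormalBasis ι ℝ E) (F : E → ℂ) (x y : E) :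
    ∑ i, (inner ℝ y (b i) : ℂ) * fderiv ℝ F x (b i) = fderiv ℝ F x y := by
  conv_rhs => rw [← b.sum_repr' y]
  simp [real_inner_comm]

variable [FiniteDimensional ℝ E]

theorem laplacian_eq_sum_fderiv (b : OrthonormalBasis ι ℝ E) {F : E → ℂ} {x : E}
    (hF : ContDiffAt ℝ 2 F x) :
    Laplacian.laplacian F x = ∑ i, fderiv ℝ (fun y => fderiv ℝ F y (b i)) x (b i) := by
  rw [InnerProductSpace.laplacian_eq_iteratedFDeriv_orthonormalBasis F b]
  refine Finset.sum_congr rfl fun i _ => ?_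
  have h : DifferentiableAt ℝ (fderiv ℝ F) x :=
    (hF.fderiv_right (m := 1) (by norm_num)).differentiableAt (by norm_num)
  rw [iteratedFDeriv_two_apply, fderiv_clm_apply h (differentiableAt_const _)]
  simp

theorem laplacian_mul (b : OrthonormalBasis ι ℝ E) {F G : E → ℂ} {x : E}
    (hF : ContDiffAt ℝ 2 F x) (hG : ContDiffAt ℝ 2 G x) :
    Laplacian.laplacian (fun y => F y * G y) x =
      F x * Laplacian.laplacian G x + G x * Laplacian.laplacian F x +
        2 * ∑ i, fderiv ℝ F x (b i) * fderiv ℝ G x (b i) := by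
  rw [laplacian_eq_sum_fderiv b hF, laplacian_eq_sum_fderiv b hG,
    laplacian_eq_sum_fderiv b (hF.mul hG), Finset.mul_sum, Finset.mul_sum, Finset.mul_sum,
    ← Finset.sum_add_distrib, ← Finset.sum_add_distrib]
  refine Finset.sum_congr rfl fun i _ => ?_
  have hev : (fun y => fderiv ℝ (fun y => F y * G y) y (b i)) =ᶠ[nhds x]
      fun y => F y * fderiv ℝ G y (b i) + G y * fderiv ℝ F y (b i) := by
    filter_upwards [hF.eventually (by simp), hG.eventually (by simp)] with y h1 h2
    exact fderiv_mul_apply (h1.differentiableAt (by simp)) (h2.differentiableAt (by simp)) _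
  have dF := hF.differentiableAt (by simp)
  have dG := hG.differentiableAt (by simp)
  have dF' := (contDiffAt_fderiv_apply (m := 1) hF (by norm_num) (b i)).differentiableAt (by simp)
  have dG' := (contDiffAt_fderiv_apply (m := 1) hG (by norm_num) (b i)).differentiableAt (by simp)
  rw [hev.fderiv_eq, fderiv_fun_add (dF.fun_mul dG') (dG.fun_mul dF'), add_apply,
    fderiv_mul_apply dF dG', fderiv_mul_apply dG dF']
  ring

/-- This is `Δ r^{2a} = 2a(2a+N-2) r^{2a-2}` at `r = 1`; `a = j/2` produces the spherical eigenvalue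
`j(j+n-2)`. -/
theorem laplacian_norm_rpow (b : OrthonormalBasis ι ℝ E) {x : E} (hx : ‖x‖ = 1) (a : ℝ) :
    Laplacian.laplacian (fun y : E => (((‖y‖ ^ 2) ^ a : ℝ) : ℂ)) x =
      (2 * a * (Fintype.card ι + 2 * (a - 1)) : ℝ) := by
  have hne : ∀ᶠ y in nhds x, ‖y‖ ^ 2 ≠ 0 := by
    have : ContinuousAt (fun y : E => ‖y‖ ^ 2) x := by fun_prop
    exact this.eventually_ne (by simp [hx])
  have hc : ContDiffAt ℝ 2 (fun y : E => (((‖y‖ ^ 2) ^ a : ℝ) : ℂ)) x := by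
    refine Complex.ofRealCLM.contDiff.contDiffAt.comp x ?_
    exact (contDiff_norm_sq ℝ).contDiffAt.rpow_const_of_ne (by simp [hx])
  rw [laplacian_eq_sum_fderiv b hc]
  have key : ∀ i, fderiv ℝ (fun y => fderiv ℝ (fun y : E => (((‖y‖ ^ 2) ^ a : ℝ) : ℂ)) y (b i)) x
      (b i) = ((2 * a + 4 * a * (a - 1) * (inner ℝ x (b i)) ^ 2 : ℝ) : ℂ) := by
    intro i
    have hev : (fun y => fderiv ℝ (fun y : E => (((‖y‖ ^ 2) ^ a : ℝ) : ℂ)) y (b i)) =ᶠ[nhds x]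
        fun y => ((2 * (a * (‖y‖ ^ 2) ^ (a - 1)) : ℝ) : ℂ) * ((inner ℝ y (b i) : ℝ) : ℂ) := by
      filter_upwards [hne] with y hy
      rw [fderiv_radial_apply (Real.hasDerivAt_rpow_const (Or.inl hy))]
      push_cast
      ring
    have h1 : HasDerivAt (fun s : ℝ => 2 * (a * s ^ (a - 1)))
        (2 * (a * ((a - 1) * (‖x‖ ^ 2) ^ (a - 1 - 1)))) (‖x‖ ^ 2) :=
      ((Real.hasDerivAt_rpow_const (Or.inl (by simp [hx]))).const_mul a).const_mul 2
    have h2 : HasFDerivAt (fun y : E => ((inner ℝ y (b i) : ℝ) : ℂ))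
        (Complex.ofRealCLM.comp (innerSL ℝ (b i))) x := by
      refine (Complex.ofRealCLM.comp (innerSL ℝ (b i))).hasFDerivAt.congr_of_eventuallyEq ?_
      exact Filter.Eventually.of_forall fun y => by simp [real_inner_comm]
    rw [hev.fderiv_eq, fderiv_mul_apply (hasFDerivAt_radial h1).differentiableAt
      h2.differentiableAt, fderiv_radial_apply h1, h2.fderiv]
    simp [hx]
    ring
  simp_rw [key]
  rw [← Complex.ofReal_sum, Finset.sum_add_distrib,
    ← Finset.mul_sum _ (fun i => inner ℝ x (b i) ^ 2)]
  have : ∑ i, inner ℝ x (b i) ^ 2 = 1 := by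
    have := b.sum_sq_norm_inner_left x
    simpa [hx] using this
  rw [this]
  simp
  ring

end Calculus

/-! ### The Laplace–Beltrami operator on smooth functions -/

section Sphere

variable {n : ℕ}

theorem radialExtension_of_ne (f : Sph n → ℂ) {y : EuclideanSpace ℝ (Fin n)} (hy : y ≠ 0)
    (x : Sph n) (hx : (x : EuclideanSpace ℝ (Fin n)) = ‖y‖⁻¹ • y) : radialExtension f y = f x := by
  rw [radialExtension, dif_neg hy]
  congr 1
  exact Subtype.ext hx.symm

theorem sph_ne_zero (x : Sph n) : (x : EuclideanSpace ℝ (Fin n)) ≠ 0 :=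
  ne_zero_of_mem_unit_sphere x

theorem sph_norm (x : Sph n) : ‖(x : EuclideanSpace ℝ (Fin n))‖ = 1 :=
  norm_eq_of_mem_sphere x

theorem radialExtension_coe (f : Sph n → ℂ) (x : Sph n) :
    radialExtension f (x : EuclideanSpace ℝ (Fin n)) = f x :=
  radialExtension_of_ne f (sph_ne_zero x) x (by simp)

theorem exists_sph_eq {y : EuclideanSpace ℝ (Fin n)} (hy : y ≠ 0) :
    ∃ x : Sph n, (x : EuclideanSpace ℝ (Fin n)) = ‖y‖⁻¹ • y :=
  ⟨⟨‖y‖⁻¹ • y, by simp [norm_smul, inv_mul_cancel₀ (norm_ne_zero_iff.mpr hy)]⟩, rfl⟩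

theorem radialExtension_smul (f : Sph n → ℂ) {r : ℝ} (hr : 0 < r)
    (y : EuclideanSpace ℝ (Fin n)) : radialExtension f (r • y) = radialExtension f y := by
  by_cases hy : y = 0
  · simp [hy]
  · obtain ⟨x, hx⟩ := exists_sph_eq hy
    rw [radialExtension_of_ne f hy x hx, radialExtension_of_ne f (smul_ne_zero hr.ne' hy) x]
    rw [hx, norm_smul, smul_smul, Real.norm_of_nonneg hr.le]
    congr 1
    field_simp

theorem radialExtension_add (f g : Sph n → ℂ) :
    radialExtension (f + g) = radialExtension f + radialExtension g := by
  ext y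
  by_cases hy : y = 0 <;> simp [radialExtension, hy]

theorem radialExtension_const_smul (c : ℂ) (f : Sph n → ℂ) :
    radialExtension (c • f) = c • radialExtension f := by
  ext y
  by_cases hy : y = 0 <;> simp [radialExtension, hy]

theorem radialExtension_star (f : Sph n → ℂ) :
    radialExtension (star f) = Complex.conjCLE ∘ radialExtension f := by
  ext y
  by_cases hy : y = 0 <;> simp [radialExtension, hy]

theorem IsSmoothOnSphere.contDiffAt {f : Sph n → ℂ} (hf : IsSmoothOnSphere f)
    {y : EuclideanSpace ℝ (Fin n)} (hy : y ≠ 0) {k : ℕ∞} :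
    ContDiffAt ℝ k (radialExtension f) y :=
  (ContDiffOn.contDiffAt hf (isOpen_compl_singleton.mem_nhds hy)).of_le (mod_cast le_top)

theorem IsSmoothOnSphere.contDiffAt_two {f : Sph n → ℂ} (hf : IsSmoothOnSphere f)
    {y : EuclideanSpace ℝ (Fin n)} (hy : y ≠ 0) :
    ContDiffAt ℝ 2 (radialExtension f) y := hf.contDiffAt (k := 2) hy

theorem IsSmoothOnSphere.add {f g : Sph n → ℂ} (hf : IsSmoothOnSphere f)
    (hg : IsSmoothOnSphere g) : IsSmoothOnSphere (f + g) := by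
  rw [IsSmoothOnSphere, radialExtension_add]
  exact ContDiffOn.add hf hg

theorem IsSmoothOnSphere.const_smul {f : Sph n → ℂ} (hf : IsSmoothOnSphere f) (c : ℂ) :
    IsSmoothOnSphere (c • f) := by
  rw [IsSmoothOnSphere, radialExtension_const_smul]
  exact ContDiffOn.const_smul c hf

theorem IsSmoothOnSphere.star {f : Sph n → ℂ} (hf : IsSmoothOnSphere f) :
    IsSmoothOnSphere (star f) := by
  rw [IsSmoothOnSphere, radialExtension_star]
  exact Complex.conjCLE.contDiff.comp_contDiffOn hf

theorem laplaceBeltrami_add {f g : Sph n → ℂ} (hf : IsSmoothOnSphere f)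
    (hg : IsSmoothOnSphere g) :
    laplaceBeltrami (f + g) = laplaceBeltrami f + laplaceBeltrami g := by
  ext x
  rw [laplaceBeltrami, radialExtension_add]
  exact (hf.contDiffAt_two (sph_ne_zero x)).laplacian_add (hg.contDiffAt_two (sph_ne_zero x))

theorem laplaceBeltrami_const_smul {f : Sph n → ℂ} (hf : IsSmoothOnSphere f) (c : ℂ) :
    laplaceBeltrami (c • f) = c • laplaceBeltrami f := by
  ext x
  rw [laplaceBeltrami, radialExtension_const_smul]
  exact InnerProductSpace.laplacian_smul c (hf.contDiffAt_two (sph_ne_zero x))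

theorem laplaceBeltrami_star (f : Sph n → ℂ) :
    laplaceBeltrami (star f) = star (laplaceBeltrami f) := by
  ext x
  rw [laplaceBeltrami, radialExtension_star, InnerProductSpace.laplacian_CLE_comp_left]
  rfl

/-- Euler's identity in degree zero: `t ↦ F (t y)` is constant for `t > 0`. -/
theorem fderiv_radialExtension_self {f : Sph n → ℂ} (hf : IsSmoothOnSphere f)
    {y : EuclideanSpace ℝ (Fin n)} (hy : y ≠ 0) : fderiv ℝ (radialExtension f) y y = 0 := by
  have h1 : HasFDerivAt (radialExtension f) (fderiv ℝ (radialExtension f) y) ((1 : ℝ) • y) := by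
    rw [one_smul]
    exact ((hf.contDiffAt_two hy).differentiableAt (by simp)).hasFDerivAt
  have h2 : HasDerivAt (fun t : ℝ => t • y) ((1 : ℝ) • y) 1 := (hasDerivAt_id (1 : ℝ)).smul_const y
  have h3 := h1.comp_hasDerivAt (1 : ℝ) h2
  rw [one_smul] at h3
  refine h3.unique ?_
  refine (hasDerivAt_const (1 : ℝ) (radialExtension f y)).congr_of_eventuallyEq ?_
  filter_upwards [lt_mem_nhds (zero_lt_one' ℝ)] with t ht
  exact radialExtension_smul f ht y

theorem fderiv_radialExtension_smul (f : Sph n → ℂ) {r : ℝ} (hr : 0 < r)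
    (y : EuclideanSpace ℝ (Fin n)) :
    fderiv ℝ (radialExtension f) y = r • fderiv ℝ (radialExtension f) (r • y) := by
  rw [← fderiv_comp_smul]
  congr 1
  ext z
  exact (radialExtension_smul f hr z).symm

/-- Homogeneity of degree `-2`, which separates the radial from the angular variable in polar
coordinates. -/
theorem laplacian_radialExtension_smul {f : Sph n → ℂ} (hf : IsSmoothOnSphere f) {r : ℝ}
    (hr : 0 < r) {y : EuclideanSpace ℝ (Fin n)} (hy : y ≠ 0) :
    Laplacian.laplacian (radialExtension f) (r • y) =
      ((r ^ 2)⁻¹ : ℝ) * Laplacian.laplacian (radialExtension f) y := by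
  have b := EuclideanSpace.basisFun (Fin n) ℝ
  rw [laplacian_eq_sum_fderiv b (hf.contDiffAt_two hy),
    laplacian_eq_sum_fderiv b (hf.contDiffAt_two (smul_ne_zero hr.ne' hy)), Finset.mul_sum]
  refine Finset.sum_congr rfl fun i _ => ?_
  have h : (fun z => fderiv ℝ (radialExtension f) z (b i)) =
      fun z => r • (fun z => fderiv ℝ (radialExtension f) z (b i)) (r • z) := by
    ext z
    rw [fderiv_radialExtension_smul f hr z]
    rfl
  conv_rhs => rw [h]
  have hd : DifferentiableAt ℝ (fun z => fderiv ℝ (radialExtension f) (r • z) (b i)) y := by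
    have h0 := ((contDiffAt_fderiv_apply (m := 1) (hf.contDiffAt_two (smul_ne_zero hr.ne' hy))
      (by norm_num) (b i)).differentiableAt (by simp))
    exact h0.comp y (differentiableAt_id.const_smul r)
  rw [fderiv_fun_const_smul hd,
    fderiv_comp_smul (f := fun z => fderiv ℝ (radialExtension f) z (b i)) r]
  simp only [smul_apply, Complex.real_smul]
  have : (r : ℂ) ≠ 0 := by exact_mod_cast hr.ne'
  push_cast
  field_simp

theorem radialExtension_eq_of_homogeneous {f : Sph n → ℂ} {q : EuclideanSpace ℝ (Fin n) → ℂ}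
    {j : ℕ} (hhom : ∀ (r : ℝ) y, q (r • y) = (r : ℂ) ^ j * q y)
    (hfq : ∀ x : Sph n, f x = q x) {y : EuclideanSpace ℝ (Fin n)} (hy : y ≠ 0) (a : ℝ)
    (ha : 2 * a = j) :
    q y = (((‖y‖ ^ 2) ^ a : ℝ) : ℂ) * radialExtension f y := by
  obtain ⟨x, hx⟩ := exists_sph_eq hy
  have h0 := norm_ne_zero_iff.mpr hy
  have h0' : (‖y‖ : ℂ) ≠ 0 := by exact_mod_cast h0
  rw [radialExtension_of_ne f hy x hx, hfq, hx, hhom, ← Real.rpow_natCast,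
    ← Real.rpow_mul (norm_nonneg _)]
  push_cast
  rw [show (2 : ℝ) * a = j from ha, Real.rpow_natCast]
  push_cast
  rw [← mul_assoc, ← mul_pow, mul_inv_cancel₀ h0', one_pow, one_mul]

theorem isSmoothOnSphere_of_homogeneous {f : Sph n → ℂ} {q : EuclideanSpace ℝ (Fin n) → ℂ}
    {j : ℕ} (hq : ContDiff ℝ ∞ q) (hhom : ∀ (r : ℝ) y, q (r • y) = (r : ℂ) ^ j * q y)
    (hfq : ∀ x : Sph n, f x = q x) : IsSmoothOnSphere f := by
  have h : ∀ y ∈ ({0}ᶜ : Set (EuclideanSpace ℝ (Fin n))),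
      radialExtension f y = (((‖y‖ ^ 2) ^ (-(j / 2 : ℝ)) : ℝ) : ℂ) * q y := by
    intro y hy
    rw [radialExtension_eq_of_homogeneous hhom hfq hy (j / 2) (by ring), ← mul_assoc,
      ← Complex.ofReal_mul, ← Real.rpow_add (by have := norm_pos_iff.mpr hy; positivity)]
    simp
  refine ContDiffOn.congr ?_ h
  refine ContDiffOn.mul ?_ hq.contDiffOn
  refine Complex.ofRealCLM.contDiff.comp_contDiffOn ?_
  exact (contDiff_norm_sq ℝ).contDiffOn.rpow_const_of_ne fun y hy => by simpa using hy

/-- Write `q = r^j F` with `F` the radial extension of `f` and apply the product rule at `r = 1`: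
the cross term vanishes by Euler's identity and `Δ r^j` contributes `j(j+n-2)`. -/
theorem laplaceBeltrami_of_homogeneous {f : Sph n → ℂ} {q : EuclideanSpace ℝ (Fin n) → ℂ}
    {j : ℕ} (hq : ContDiff ℝ ∞ q) (hhom : ∀ (r : ℝ) y, q (r • y) = (r : ℂ) ^ j * q y)
    (hfq : ∀ x : Sph n, f x = q x) (x : Sph n) :
    laplaceBeltrami f x = Laplacian.laplacian q (x : EuclideanSpace ℝ (Fin n)) -
      (j * (j + n - 2) : ℂ) * f x := by
  have b := EuclideanSpace.basisFun (Fin n) ℝ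
  have hf := isSmoothOnSphere_of_homogeneous hq hhom hfq
  have hx := sph_ne_zero x
  have hev : q =ᶠ[nhds (x : EuclideanSpace ℝ (Fin n))]
      fun y => (((‖y‖ ^ 2) ^ (j / 2 : ℝ) : ℝ) : ℂ) * radialExtension f y := by
    filter_upwards [isOpen_compl_singleton.mem_nhds hx] with y hy
    exact radialExtension_eq_of_homogeneous hhom hfq hy (j / 2) (by ring)
  have hN : ContDiffAt ℝ 2 (fun y : EuclideanSpace ℝ (Fin n) =>
      (((‖y‖ ^ 2) ^ (j / 2 : ℝ) : ℝ) : ℂ)) x :=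
    Complex.ofRealCLM.contDiff.contDiffAt.comp _
      ((contDiff_norm_sq ℝ).contDiffAt.rpow_const_of_ne (by simp))
  have hd : HasDerivAt (fun s : ℝ => s ^ (j / 2 : ℝ)) _ (‖(x : EuclideanSpace ℝ (Fin n))‖ ^ 2) :=
    Real.hasDerivAt_rpow_const (Or.inl (by simp))
  have hsum : ∑ i, fderiv ℝ (fun y : EuclideanSpace ℝ (Fin n) =>
      (((‖y‖ ^ 2) ^ (j / 2 : ℝ) : ℝ) : ℂ)) x (b i) * fderiv ℝ (radialExtension f) x (b i) = 0 := by
    simp_rw [fderiv_radial_apply hd]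
    push_cast
    simp_rw [mul_assoc, ← Finset.mul_sum]
    rw [sum_inner_mul_fderiv, fderiv_radialExtension_self hf hx]
    simp
  rw [InnerProductSpace.laplacian_congr_nhds hev |>.eq_of_nhds,
    laplacian_mul b hN (hf.contDiffAt_two hx), hsum,
    laplacian_norm_rpow b (sph_norm x), radialExtension_coe, laplaceBeltrami]
  simp
  ring

end Sphere

/-! ### Symmetry of the Laplace–Beltrami operator -/

section Symmetry

variable {n : ℕ}

/-- Only integrands that split as angular times radial are treated, since for products the Fubini
formula needs no integrability. -/
theorem integral_polar [Nontrivial (EuclideanSpace ℝ (Fin n))] {g : EuclideanSpace ℝ (Fin n) → ℂ}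
    {u : Sph n → ℂ} {k : Set.Ioi (0 : ℝ) → ℂ}
    (h : ∀ (x : Sph n) (r : Set.Ioi (0 : ℝ)),
      g ((r : ℝ) • (x : EuclideanSpace ℝ (Fin n))) = u x * k r) :
    ∫ y, g y = (∫ x, u x ∂surfaceMeasure n) * ∫ r, k r ∂(Measure.volumeIoiPow
      (Module.finrank ℝ (EuclideanSpace ℝ (Fin n)) - 1)) := by
  have h1 : ∫ y, g y = ∫ y : ({0}ᶜ : Set (EuclideanSpace ℝ (Fin n))), g y
      ∂((volume : Measure (EuclideanSpace ℝ (Fin n))).comap Subtype.val) := by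
    rw [integral_subtype_comap (measurableSet_singleton _).compl fun y => g y,
      restrict_compl_singleton]
  rw [h1, ← integral_prod_mul,
    ← (volume : Measure (EuclideanSpace ℝ (Fin n))).measurePreserving_homeomorphUnitSphereProd
      |>.integral_comp (Homeomorph.measurableEmbedding _)]
  refine integral_congr_ae (Filter.Eventually.of_forall fun y => ?_)
  have hy : ‖(y : EuclideanSpace ℝ (Fin n))‖ ≠ 0 := norm_ne_zero_iff.mpr y.2
  simp only
  rw [← h]
  simp [smul_smul, mul_inv_cancel₀ hy]

/-- A smooth bump on the half-line, used to localize to an annulus. -/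
def annulusBump : ContDiffBump (1 : ℝ) := ⟨1 / 4, 1 / 2, by norm_num, by norm_num⟩

theorem annulusBump_eq_zero {s : ℝ} (hs : s ≤ 1 / 2 ∨ 3 / 2 ≤ s) : annulusBump s = 0 := by
  refine annulusBump.zero_of_le_dist ?_
  change (1 / 2 : ℝ) ≤ _
  rw [Real.dist_eq]
  rcases hs with hs | hs
  · rw [abs_sub_comm]; exact le_trans (by linarith) (le_abs_self _)
  · exact le_trans (by linarith) (le_abs_self _)

theorem annulusBump_norm_eventually_eq_zero :
    ∀ᶠ y in nhds (0 : EuclideanSpace ℝ (Fin n)), annulusBump (‖y‖ ^ 2) = 0 := by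
  have hc : ContinuousAt (fun y : EuclideanSpace ℝ (Fin n) => ‖y‖ ^ 2) 0 := by fun_prop
  filter_upwards [hc.eventually_lt_const (u := 1 / 2) (by norm_num)] with y hy
  exact annulusBump_eq_zero (Or.inl hy.le)

theorem contDiff_annulusBump_mul {k : ℕ∞} {u : EuclideanSpace ℝ (Fin n) → ℂ}
    (hu : ∀ y ≠ 0, ContDiffAt ℝ k u y) :
    ContDiff ℝ k fun y => ((annulusBump (‖y‖ ^ 2) : ℝ) : ℂ) * u y := by
  rw [contDiff_iff_contDiffAt]
  intro y
  by_cases hy : y = 0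
  · subst hy
    refine contDiffAt_const (c := (0 : ℂ)) |>.congr_of_eventuallyEq ?_
    filter_upwards [annulusBump_norm_eventually_eq_zero] with y hy
    simp [hy]
  · refine ContDiffAt.mul ?_ (hu y hy)
    exact Complex.ofRealCLM.contDiff.contDiffAt.comp _
      (annulusBump.contDiff.contDiffAt.comp _ (contDiff_norm_sq ℝ).contDiffAt)

theorem hasCompactSupport_annulusBump_mul (u : EuclideanSpace ℝ (Fin n) → ℂ) :
    HasCompactSupport fun y => ((annulusBump (‖y‖ ^ 2) : ℝ) : ℂ) * u y := by
  refine HasCompactSupport.intro (isCompact_closedBall (0 : EuclideanSpace ℝ (Fin n)) 2)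
    fun y hy => ?_
  have : 2 < ‖y‖ := by simpa using hy
  rw [annulusBump_eq_zero (Or.inr (by nlinarith))]
  simp

/-- Polar coordinates run backwards, with angular factor `1`: a vanishing radial integral would make
the integral over `ℝⁿ` of a nonnegative, nonzero continuous bump vanish. -/
theorem integral_annulusBump_ne_zero [Nontrivial (EuclideanSpace ℝ (Fin n))] :
    ∫ r : Set.Ioi (0 : ℝ), ((annulusBump ((r : ℝ) ^ 2) * ((r : ℝ) ^ 2)⁻¹ : ℝ) : ℂ)
      ∂(Measure.volumeIoiPow (Module.finrank ℝ (EuclideanSpace ℝ (Fin n)) - 1)) ≠ 0 := by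
  intro h0
  have hsm : ContDiff ℝ 0 fun y : EuclideanSpace ℝ (Fin n) =>
      ((annulusBump (‖y‖ ^ 2) : ℝ) : ℂ) * (((‖y‖ ^ 2)⁻¹ : ℝ) : ℂ) := by
    refine contDiff_annulusBump_mul (k := 0) fun y hy => ?_
    exact Complex.ofRealCLM.contDiff.contDiffAt.comp _
      ((contDiff_norm_sq ℝ).contDiffAt.inv (by simpa using hy))
  have h1 := integral_polar (n := n) (u := fun _ => 1)
    (g := fun y => ((annulusBump (‖y‖ ^ 2) : ℝ) : ℂ) * (((‖y‖ ^ 2)⁻¹ : ℝ) : ℂ))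
    (k := fun r => ((annulusBump ((r : ℝ) ^ 2) * ((r : ℝ) ^ 2)⁻¹ : ℝ) : ℂ))
    (fun x r => by
      have hr : (0 : ℝ) < r := r.2
      simp [norm_smul, abs_of_pos hr])
  rw [h0, mul_zero] at h1
  simp_rw [← Complex.ofReal_mul] at h1
  rw [integral_complex_ofReal, Complex.ofReal_eq_zero] at h1
  obtain ⟨x, hx⟩ := exists_norm_eq (EuclideanSpace ℝ (Fin n)) zero_le_one
  refine absurd h1 (ne_of_gt ?_)
  have hcont : Continuous fun y : EuclideanSpace ℝ (Fin n) =>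
      annulusBump (‖y‖ ^ 2) * (‖y‖ ^ 2)⁻¹ := by
    have := Complex.continuous_re.comp hsm.continuous
    refine this.congr fun y => ?_
    simp only [Function.comp, ← Complex.ofReal_mul, Complex.ofReal_re]
  refine hcont.integral_pos_of_hasCompactSupport_nonneg_nonzero (x := x) ?_ ?_ ?_
  · have := hasCompactSupport_annulusBump_mul (n := n) fun y => (((‖y‖ ^ 2)⁻¹ : ℝ) : ℂ)
    refine (this.comp_left (g := Complex.re) rfl).mono' ?_
    intro y hy
    refine subset_closure ?_
    simpa only [Function.mem_support, Function.comp, ← Complex.ofReal_mul, Complex.ofReal_re]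
      using hy
  · intro y
    exact mul_nonneg annulusBump.nonneg (by positivity)
  · rw [hx, one_pow, inv_one, mul_one, annulusBump.one_of_mem_closedBall
      (Metric.mem_closedBall_self annulusBump.rIn_pos.le)]
    exact one_ne_zero

theorem integral_fderiv_apply_eq_zero {V : EuclideanSpace ℝ (Fin n) → ℂ} (hV : ContDiff ℝ 1 V)
    (hc : HasCompactSupport V) (v : EuclideanSpace ℝ (Fin n)) : ∫ y, fderiv ℝ V y v = 0 := by
  have hi : Integrable fun y => fderiv ℝ V y v :=
    ((hV.continuous_fderiv (by simp)).clm_apply continuous_const).integrable_of_hasCompactSupport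
      (hc.fderiv_apply (𝕜 := ℝ) v)
  have := integral_mul_fderiv_eq_neg_fderiv_mul_of_integrable (μ := volume)
    (f := fun _ : EuclideanSpace ℝ (Fin n) => (1 : ℂ)) (g := V) (v := v) (by simp)
    (by simpa using hi) (by simpa using hV.continuous.integrable_of_hasCompactSupport hc)
    (fun _ _ => differentiableAt_const _) (fun y _ => hV.differentiable (by simp) y)
  simpa using this

/-- The divergence of `χ(|y|²)(G ∇F - F ∇G)`, where `F`, `G` are the extensions of `φ`, `ψ`: the
terms `∇F · ∇G` cancel, and the gradient of the cutoff is radial, so it only meets radial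
derivatives of `F` and `G`, which are zero. -/
theorem sum_fderiv_annulusBump_mul {φ ψ : Sph n → ℂ} (hφ : IsSmoothOnSphere φ)
    (hψ : IsSmoothOnSphere ψ) (b : OrthonormalBasis (Fin n) ℝ (EuclideanSpace ℝ (Fin n)))
    (y : EuclideanSpace ℝ (Fin n)) :
    ∑ i, fderiv ℝ (fun y => ((annulusBump (‖y‖ ^ 2) : ℝ) : ℂ) *
      (radialExtension ψ y * fderiv ℝ (radialExtension φ) y (b i) -
        radialExtension φ y * fderiv ℝ (radialExtension ψ) y (b i))) y (b i) =
    ((annulusBump (‖y‖ ^ 2) : ℝ) : ℂ) *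
      (radialExtension ψ y * Laplacian.laplacian (radialExtension φ) y -
        radialExtension φ y * Laplacian.laplacian (radialExtension ψ) y) := by
  by_cases hy : y = 0
  · subst hy
    rw [annulusBump_norm_eventually_eq_zero.self_of_nhds, Complex.ofReal_zero, zero_mul]
    refine Finset.sum_eq_zero fun i _ => ?_
    have : (fun y => ((annulusBump (‖y‖ ^ 2) : ℝ) : ℂ) *
      (radialExtension ψ y * fderiv ℝ (radialExtension φ) y (b i) -
        radialExtension φ y * fderiv ℝ (radialExtension ψ) y (b i))) =ᶠ[nhds 0] fun _ => 0 := by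
      filter_upwards [annulusBump_norm_eventually_eq_zero] with y hy
      simp [hy]
    rw [this.fderiv_eq]
    simp
  · have hF := hφ.contDiffAt_two hy
    have hG := hψ.contDiffAt_two hy
    rw [laplacian_eq_sum_fderiv b hF, laplacian_eq_sum_fderiv b hG]
    have dF := hF.differentiableAt (by simp)
    have dG := hG.differentiableAt (by simp)
    have hd : HasDerivAt annulusBump (deriv annulusBump (‖y‖ ^ 2)) (‖y‖ ^ 2) :=
      ((annulusBump.contDiff (n := 1)).differentiable (by simp) _).hasDerivAt
    have key : ∀ i, fderiv ℝ (fun y => ((annulusBump (‖y‖ ^ 2) : ℝ) : ℂ) *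
        (radialExtension ψ y * fderiv ℝ (radialExtension φ) y (b i) -
          radialExtension φ y * fderiv ℝ (radialExtension ψ) y (b i))) y (b i) =
        ((annulusBump (‖y‖ ^ 2) : ℝ) : ℂ) *
          (radialExtension ψ y * fderiv ℝ (fun z => fderiv ℝ (radialExtension φ) z (b i)) y (b i) -
          radialExtension φ y * fderiv ℝ (fun z => fderiv ℝ (radialExtension ψ) z (b i)) y (b i)) +
        2 * (deriv annulusBump (‖y‖ ^ 2) : ℝ) * radialExtension ψ y *
          ((inner ℝ y (b i) : ℂ) * fderiv ℝ (radialExtension φ) y (b i)) -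
        2 * (deriv annulusBump (‖y‖ ^ 2) : ℝ) * radialExtension φ y *
          ((inner ℝ y (b i) : ℂ) * fderiv ℝ (radialExtension ψ) y (b i)) := by
      intro i
      have dF' := (contDiffAt_fderiv_apply (m := 1) hF (by norm_num) (b i)).differentiableAt
        (by simp)
      have dG' := (contDiffAt_fderiv_apply (m := 1) hG (by norm_num) (b i)).differentiableAt
        (by simp)
      rw [fderiv_mul_apply (hasFDerivAt_radial hd).differentiableAt
        ((dG.fun_mul dF').fun_sub (dF.fun_mul dG')),
        fderiv_fun_sub (dG.fun_mul dF') (dF.fun_mul dG'), sub_apply,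
        fderiv_mul_apply dG dF', fderiv_mul_apply dF dG', fderiv_radial_apply hd]
      push_cast
      ring
    simp_rw [key]
    rw [Finset.sum_sub_distrib, Finset.sum_add_distrib, ← Finset.mul_sum, ← Finset.mul_sum,
      ← Finset.mul_sum, sum_inner_mul_fderiv, sum_inner_mul_fderiv,
      fderiv_radialExtension_self hφ hy, fderiv_radialExtension_self hψ hy,
      Finset.sum_sub_distrib, Finset.mul_sum, Finset.mul_sum]
    simp

/-- Green's identity on the sphere, deduced from `ℝⁿ`: a compactly supported divergence integrates
to zero, and its integral factors into the spherical integral times a nonzero radial constant. -/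
theorem integral_laplaceBeltrami_mul_sub [Nontrivial (EuclideanSpace ℝ (Fin n))]
    {φ ψ : Sph n → ℂ} (hφ : IsSmoothOnSphere φ) (hψ : IsSmoothOnSphere ψ) :
    ∫ x, (ψ x * laplaceBeltrami φ x - φ x * laplaceBeltrami ψ x) ∂surfaceMeasure n = 0 := by
  have b := EuclideanSpace.basisFun (Fin n) ℝ
  have hV : ∀ i, ContDiff ℝ 1 fun y => ((annulusBump (‖y‖ ^ 2) : ℝ) : ℂ) *
      (radialExtension ψ y * fderiv ℝ (radialExtension φ) y (b i) -
        radialExtension φ y * fderiv ℝ (radialExtension ψ) y (b i)) := fun i =>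
    contDiff_annulusBump_mul (k := 1) fun y hy =>
      ((hψ.contDiffAt hy).mul (contDiffAt_fderiv_apply (m := 1) (hφ.contDiffAt_two hy)
        (by norm_num) _)).sub ((hφ.contDiffAt hy).mul
          (contDiffAt_fderiv_apply (m := 1) (hψ.contDiffAt_two hy) (by norm_num) _))
  have h1 : ∫ y, ((annulusBump (‖y‖ ^ 2) : ℝ) : ℂ) *
      (radialExtension ψ y * Laplacian.laplacian (radialExtension φ) y -
        radialExtension φ y * Laplacian.laplacian (radialExtension ψ) y) = 0 := by
    simp_rw [← sum_fderiv_annulusBump_mul hφ hψ b]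
    rw [integral_finsetSum]
    · exact Finset.sum_eq_zero fun i _ => integral_fderiv_apply_eq_zero (hV i)
        (hasCompactSupport_annulusBump_mul _) _
    · intro i _
      exact (((hV i).continuous_fderiv (by simp)).clm_apply
        continuous_const).integrable_of_hasCompactSupport
        ((hasCompactSupport_annulusBump_mul _).fderiv_apply (𝕜 := ℝ) _)
  have h2 := integral_polar (n := n)
    (u := fun x => ψ x * laplaceBeltrami φ x - φ x * laplaceBeltrami ψ x)
    (k := fun r => ((annulusBump ((r : ℝ) ^ 2) * ((r : ℝ) ^ 2)⁻¹ : ℝ) : ℂ))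
    (g := fun y => ((annulusBump (‖y‖ ^ 2) : ℝ) : ℂ) *
      (radialExtension ψ y * Laplacian.laplacian (radialExtension φ) y -
        radialExtension φ y * Laplacian.laplacian (radialExtension ψ) y))
    (fun x r => by
      have hr : (0 : ℝ) < r := r.2
      rw [laplacian_radialExtension_smul hφ hr (sph_ne_zero x),
        laplacian_radialExtension_smul hψ hr (sph_ne_zero x), radialExtension_smul φ hr,
        radialExtension_smul ψ hr, radialExtension_coe, radialExtension_coe, norm_smul, sph_norm,
        Real.norm_of_nonneg hr.le, mul_one, laplaceBeltrami, laplaceBeltrami]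
      push_cast
      ring)
  rw [h1] at h2
  exact (mul_eq_zero.mp h2.symm).resolve_right integral_annulusBump_ne_zero

end Symmetry

/-! ### Spherical harmonics -/

section Harmonics

variable {n : ℕ}

/-- The eigenvalues `k(k+n-2)` of `-Δ` on the sphere. -/
def sphEigenvalue (n k : ℕ) : ℝ := (k : ℝ) * (k + n - 2)

theorem sphEigenvalue_strictMono (hn : 2 ≤ n) : StrictMono (sphEigenvalue n) := by
  refine strictMono_nat_of_lt_succ fun k => ?_
  have h : (2 : ℝ) ≤ n := by exact_mod_cast hn
  have hk : (0 : ℝ) ≤ k := k.cast_nonneg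
  rw [sphEigenvalue, sphEigenvalue]
  push_cast
  nlinarith

theorem sq_le_sphEigenvalue (hn : 2 ≤ n) (k : ℕ) : (k : ℝ) ^ 2 ≤ sphEigenvalue n k := by
  have h : (2 : ℝ) ≤ n := by exact_mod_cast hn
  have hk : (0 : ℝ) ≤ k := k.cast_nonneg
  rw [sphEigenvalue]
  nlinarith

/-- The restriction to the sphere of the power `y ↦ ⟪c, y⟫ ^ j` of a linear form. -/
def ridge (c : EuclideanSpace ℝ (Fin n)) (j : ℕ) : C(Sph n, ℂ) :=
  ⟨fun x => ((inner ℝ c (x : EuclideanSpace ℝ (Fin n)) : ℝ) : ℂ) ^ j, by fun_prop⟩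

theorem ridge_apply (c : EuclideanSpace ℝ (Fin n)) (j : ℕ) (x : Sph n) :
    ridge c j x = ((inner ℝ c (x : EuclideanSpace ℝ (Fin n)) : ℝ) : ℂ) ^ j := rfl

theorem ridge_one_pow (c : EuclideanSpace ℝ (Fin n)) (j : ℕ) : ridge c 1 ^ j = ridge c j := by
  ext x
  simp [ridge_apply]

theorem hasFDerivAt_inner_pow (c y : EuclideanSpace ℝ (Fin n)) (j : ℕ) :
    HasFDerivAt (fun y : EuclideanSpace ℝ (Fin n) => ((inner ℝ c y : ℝ) : ℂ) ^ j)
      ((j * ((inner ℝ c y : ℝ) : ℂ) ^ (j - 1)) • Complex.ofRealCLM.comp (innerSL ℝ c)) y := by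
  have h : HasFDerivAt (fun y : EuclideanSpace ℝ (Fin n) => ((inner ℝ c y : ℝ) : ℂ))
      (Complex.ofRealCLM.comp (innerSL ℝ c)) y :=
    (Complex.ofRealCLM.comp (innerSL ℝ c)).hasFDerivAt
  refine (h.pow j).congr_fderiv ?_
  ext v
  simp

theorem contDiff_inner_pow (c : EuclideanSpace ℝ (Fin n)) (j : ℕ) {k : WithTop ℕ∞} :
    ContDiff ℝ k (fun y : EuclideanSpace ℝ (Fin n) => ((inner ℝ c y : ℝ) : ℂ) ^ j) :=
  (Complex.ofRealCLM.comp (innerSL ℝ c)).contDiff.pow j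

/-- The truncated exponent `j - 2` is harmless: for `j ≤ 1` the factor `j(j-1)` is zero. -/
theorem laplacian_inner_pow (c y : EuclideanSpace ℝ (Fin n)) (j : ℕ) :
    Laplacian.laplacian (fun y : EuclideanSpace ℝ (Fin n) => ((inner ℝ c y : ℝ) : ℂ) ^ j) y =
      (j * (j - 1) * ‖c‖ ^ 2 : ℂ) * ((inner ℝ c y : ℝ) : ℂ) ^ (j - 2) := by
  have b := EuclideanSpace.basisFun (Fin n) ℝ
  rw [laplacian_eq_sum_fderiv b (contDiff_inner_pow c j).contDiffAt]
  have key : ∀ i, fderiv ℝ (fun z => fderiv ℝ (fun y : EuclideanSpace ℝ (Fin n) =>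
      ((inner ℝ c y : ℝ) : ℂ) ^ j) z (b i)) y (b i) =
      (j * (j - 1) * ((inner ℝ c y : ℝ) : ℂ) ^ (j - 2)) * (((inner ℝ c (b i)) ^ 2 : ℝ) : ℂ) := by
    intro i
    have h1 : (fun z => fderiv ℝ (fun y : EuclideanSpace ℝ (Fin n) =>
        ((inner ℝ c y : ℝ) : ℂ) ^ j) z (b i)) =
        fun z => ((inner ℝ c z : ℝ) : ℂ) ^ (j - 1) * (j * ((inner ℝ c (b i) : ℝ) : ℂ)) := by
      ext z
      rw [(hasFDerivAt_inner_pow c z j).fderiv]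
      simp
      ring
    rw [h1, ((hasFDerivAt_inner_pow c y (j - 1)).mul_const _).fderiv]
    rcases j with _ | j
    · simp
    · simp
      ring
  simp_rw [key]
  rw [← Finset.mul_sum, ← Complex.ofReal_sum]
  have : ∑ i, inner ℝ c (b i) ^ 2 = ‖c‖ ^ 2 := by
    have := b.sum_sq_norm_inner_left c
    simpa using this
  rw [this]
  push_cast
  ring

theorem isSmoothOnSphere_ridge (c : EuclideanSpace ℝ (Fin n)) (j : ℕ) :
    IsSmoothOnSphere (ridge c j) :=
  isSmoothOnSphere_of_homogeneous (j := j) (contDiff_inner_pow c j)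
    (fun r y => by simp [inner_smul_right, mul_pow]) (fun _ => rfl)

theorem laplaceBeltrami_ridge (c : EuclideanSpace ℝ (Fin n)) (j : ℕ) (x : Sph n) :
    laplaceBeltrami (ridge c j) x =
      (j * (j - 1) * ‖c‖ ^ 2 : ℂ) * ridge c (j - 2) x - (sphEigenvalue n j : ℂ) * ridge c j x := by
  rw [laplaceBeltrami_of_homogeneous (f := ridge c j) (j := j) (contDiff_inner_pow c j)
    (fun r y => by simp [inner_smul_right, mul_pow]) (fun _ => rfl), laplacian_inner_pow]
  simp [sphEigenvalue, ridge_apply]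

/-- The restrictions to the sphere of the polynomials of degree at most `k`. -/
def polySpace (n k : ℕ) : Submodule ℂ C(Sph n, ℂ) :=
  Submodule.span ℂ {f | ∃ c j, j ≤ k ∧ f = ridge c j}

theorem ridge_mem_polySpace (c : EuclideanSpace ℝ (Fin n)) {j k : ℕ} (h : j ≤ k) :
    ridge c j ∈ polySpace n k :=
  Submodule.subset_span ⟨c, j, h, rfl⟩

theorem polySpace_mono {j k : ℕ} (h : j ≤ k) : polySpace n j ≤ polySpace n k :=
  Submodule.span_mono fun _ ⟨c, i, hi, hf⟩ => ⟨c, i, hi.trans h, hf⟩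

theorem isSmoothOnSphere_of_mem_polySpace {k : ℕ} {f : C(Sph n, ℂ)} (hf : f ∈ polySpace n k) :
    IsSmoothOnSphere f := by
  induction hf using Submodule.span_induction with
  | mem f hf => obtain ⟨c, j, -, rfl⟩ := hf; exact isSmoothOnSphere_ridge c j
  | zero =>
    have h := (isSmoothOnSphere_ridge (0 : EuclideanSpace ℝ (Fin n)) 0).const_smul 0
    rw [zero_smul] at h
    exact h
  | add f g _ _ hf hg => exact hf.add hg
  | smul c f _ hf => exact hf.const_smul c

/-- The span `M` of `1` and the coordinate functions is finitely generated, hence so is `M ^ k`;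
padding `ridge c j` with factors `1` puts it into `M ^ k`. -/
instance finiteDimensional_polySpace (k : ℕ) : FiniteDimensional ℂ (polySpace n k) := by
  set M : Submodule ℂ C(Sph n, ℂ) := Submodule.span ℂ
    (insert 1 (Set.range fun i => ridge (EuclideanSpace.basisFun (Fin n) ℝ i) 1)) with hM
  have hfg : (M ^ k).FG := (Submodule.fg_span ((Set.finite_range _).insert 1)).pow k
  have : FiniteDimensional ℂ ↥(M ^ k) := Module.Finite.iff_fg.mpr hfg
  have h1 : (1 : C(Sph n, ℂ)) ∈ M := Submodule.subset_span (Set.mem_insert _ _)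
  have hc : ∀ c, ridge c 1 ∈ M := by
    intro c
    have : ridge c 1 = ∑ i, ((c i : ℝ) : ℂ) • ridge (EuclideanSpace.basisFun (Fin n) ℝ i) 1 := by
      ext x
      simp [ridge_apply, PiLp.inner_apply, mul_comm]
    rw [this]
    exact Submodule.sum_mem _ fun i _ => Submodule.smul_mem _ _
      (Submodule.subset_span (Set.mem_insert_of_mem _ ⟨i, rfl⟩))
  refine Submodule.finiteDimensional_of_le (S₂ := M ^ k) (Submodule.span_le.mpr ?_)
  rintro _ ⟨c, j, hj, rfl⟩
  obtain ⟨m, rfl⟩ := Nat.exists_eq_add_of_le hj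
  have h2 : ridge c j = ridge c 1 ^ j * 1 ^ m := by rw [one_pow, mul_one, ridge_one_pow]
  have h3 : M ^ (j + m) = M ^ j * M ^ m := pow_add M j m
  rw [h2, SetLike.mem_coe, h3]
  exact Submodule.mul_mem_mul (Submodule.pow_mem_pow _ (hc c) j) (Submodule.pow_mem_pow _ h1 m)

/-- The spherical harmonics of degree `k`. -/
def harmSpace (n k : ℕ) : Submodule ℂ C(Sph n, ℂ) where
  carrier := {f | f ∈ polySpace n k ∧ laplaceBeltrami f = (-(sphEigenvalue n k : ℂ)) • ⇑f}
  add_mem' := by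
    rintro f g ⟨hf, hf'⟩ ⟨hg, hg'⟩
    refine ⟨add_mem hf hg, ?_⟩
    rw [ContinuousMap.coe_add, laplaceBeltrami_add (isSmoothOnSphere_of_mem_polySpace hf)
      (isSmoothOnSphere_of_mem_polySpace hg), hf', hg', smul_add]
  zero_mem' := by
    refine ⟨zero_mem _, ?_⟩
    have h := laplaceBeltrami_const_smul (isSmoothOnSphere_ridge (0 : EuclideanSpace ℝ (Fin n)) 0) 0
    rw [zero_smul, zero_smul] at h
    rw [ContinuousMap.coe_zero, h, smul_zero]
  smul_mem' := by
    rintro c f ⟨hf, hf'⟩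
    refine ⟨Submodule.smul_mem _ c hf, ?_⟩
    rw [ContinuousMap.coe_smul, laplaceBeltrami_const_smul (isSmoothOnSphere_of_mem_polySpace hf),
      hf', smul_comm]

theorem harmSpace_le_polySpace (k : ℕ) : harmSpace n k ≤ polySpace n k := fun _ h => h.1

instance finiteDimensional_harmSpace (k : ℕ) : FiniteDimensional ℂ (harmSpace n k) :=
  Submodule.finiteDimensional_of_le (harmSpace_le_polySpace k)

theorem isSmoothOnSphere_of_mem_harmSpace {k : ℕ} {f : C(Sph n, ℂ)} (hf : f ∈ harmSpace n k) :
    IsSmoothOnSphere f := isSmoothOnSphere_of_mem_polySpace hf.1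

/-- On degree `i < j` the operator `Δ + ν_j` is multiplication by `ν_j - ν_i ≠ 0`, so it can be
inverted on sums of harmonics of lower degree. -/
theorem exists_laplaceBeltrami_add_smul_eq (hn : 2 ≤ n) (j : ℕ) {g : C(Sph n, ℂ)}
    (hg : g ∈ ⨆ i : Fin j, harmSpace n i) :
    ∃ u ∈ ⨆ i : Fin j, harmSpace n i, u ∈ polySpace n j ∧
      laplaceBeltrami u + (sphEigenvalue n j : ℂ) • ⇑u = g := by
  induction hg using Submodule.iSup_induction' with
  | mem i g hg =>
    have hne : (sphEigenvalue n j : ℂ) - sphEigenvalue n i ≠ 0 := by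
      rw [sub_ne_zero]
      exact_mod_cast (sphEigenvalue_strictMono hn i.2).ne'
    refine ⟨((sphEigenvalue n j : ℂ) - sphEigenvalue n i)⁻¹ • g,
      Submodule.smul_mem _ _ (Submodule.mem_iSup_of_mem i hg),
      Submodule.smul_mem _ _ (polySpace_mono i.2.le hg.1), ?_⟩
    rw [ContinuousMap.coe_smul, laplaceBeltrami_const_smul (isSmoothOnSphere_of_mem_harmSpace hg),
      hg.2, smul_smul, smul_smul, ← add_smul]
    convert one_smul ℂ _
    field_simp
    ring
  | zero =>
    have h := laplaceBeltrami_const_smul (isSmoothOnSphere_ridge (0 : EuclideanSpace ℝ (Fin n)) 0) 0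
    rw [zero_smul, zero_smul] at h
    exact ⟨0, zero_mem _, zero_mem _, by rw [ContinuousMap.coe_zero, h, smul_zero, add_zero]⟩
  | add f g _ _ hf hg =>
    obtain ⟨u, hu, hu', hu''⟩ := hf
    obtain ⟨v, hv, hv', hv''⟩ := hg
    refine ⟨u + v, add_mem hu hv, add_mem hu' hv', ?_⟩
    rw [ContinuousMap.coe_add, laplaceBeltrami_add (isSmoothOnSphere_of_mem_polySpace hu')
      (isSmoothOnSphere_of_mem_polySpace hv'), ContinuousMap.coe_add, ← hu'', ← hv'', smul_add]
    abel

/-- `Δ + ν_j` sends `ridge c j` to a multiple of `ridge c (j - 2)`, which by induction is a sum of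
harmonics of lower degree. Subtracting a lower-degree solution `u` of the same equation leaves a
harmonic of degree `j`. -/
theorem ridge_mem_iSup_harmSpace (hn : 2 ≤ n) (c : EuclideanSpace ℝ (Fin n)) (j : ℕ) :
    ridge c j ∈ ⨆ i : Fin (j + 1), harmSpace n i := by
  induction j using Nat.strong_induction_on with
  | _ j ih =>
    have hg : (j * (j - 1) * ‖c‖ ^ 2 : ℂ) • ridge c (j - 2) ∈ ⨆ i : Fin j, harmSpace n i := by
      rcases Nat.lt_or_ge j 2 with hj | hj
      · have : (j * (j - 1) * ‖c‖ ^ 2 : ℂ) = 0 := by interval_cases j <;> simp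
        have h0 : (j * (j - 1) * ‖c‖ ^ 2 : ℂ) • ridge c (j - 2) = 0 := by
          ext x
          rw [this, ContinuousMap.smul_apply, zero_smul, ContinuousMap.zero_apply]
        rw [h0]
        exact zero_mem _
      · refine Submodule.smul_mem _ _ ?_
        refine SetLike.le_def.mp (iSup_le fun i => ?_) (ih (j - 2) (by omega))
        exact le_iSup (fun i : Fin j => harmSpace n i) ⟨i, by omega⟩
    obtain ⟨u, hu, hu', hu''⟩ := exists_laplaceBeltrami_add_smul_eq hn j hg
    have hw : ridge c j - u ∈ harmSpace n j := by
      refine ⟨sub_mem (ridge_mem_polySpace c le_rfl) hu', ?_⟩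
      have h1 : ⇑(ridge c j - u) = ⇑(ridge c j) + (-1 : ℂ) • ⇑u := by
        ext x; simp [sub_eq_add_neg]
      have hus := isSmoothOnSphere_of_mem_polySpace hu'
      rw [h1, laplaceBeltrami_add (isSmoothOnSphere_ridge c j) (hus.const_smul _),
        laplaceBeltrami_const_smul hus]
      ext x
      have h2 := congrFun hu'' x
      simp only [Pi.add_apply, Pi.smul_apply, smul_eq_mul, ContinuousMap.smul_apply] at h2 ⊢
      rw [laplaceBeltrami_ridge, ← h2]
      ring
    have : ridge c j = u + (ridge c j - u) := by abel
    rw [this]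
    refine add_mem ?_ (Submodule.mem_iSup_of_mem (Fin.last j) (by simpa using hw))
    refine SetLike.le_def.mp (iSup_le fun i => ?_) hu
    exact le_iSup (fun i : Fin (j + 1) => harmSpace n i) ⟨i, by omega⟩

theorem ridge_mem_iSup (hn : 2 ≤ n) (c : EuclideanSpace ℝ (Fin n)) (j : ℕ) :
    ridge c j ∈ ⨆ i, harmSpace n i :=
  SetLike.le_def.mp (iSup_le fun i : Fin (j + 1) => le_iSup (harmSpace n) i)
    (ridge_mem_iSup_harmSpace hn c j)

/-- The star subalgebra generated by the exponentials of linear forms. -/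
def expAlgebra (n : ℕ) : StarSubalgebra ℂ C(Sph n, ℂ) :=
  { Algebra.adjoin ℂ (Set.range fun c : EuclideanSpace ℝ (Fin n) =>
      NormedSpace.exp (ridge c 1)) with
    star_mem' := by
      intro f hf
      induction hf using Algebra.adjoin_induction with
      | mem f hf =>
        obtain ⟨c, rfl⟩ := hf
        have h : star (ridge c 1) = ridge c 1 := by ext x; simp [ridge_apply]
        change star (NormedSpace.exp (ridge c 1)) ∈ _
        rw [NormedSpace.star_exp, h]
        exact Algebra.subset_adjoin ⟨c, rfl⟩
      | algebraMap r =>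
        rw [← algebraMap_star_comm]
        exact Subalgebra.algebraMap_mem _ _
      | add f g _ _ hf hg => rw [star_add]; exact Subalgebra.add_mem _ hf hg
      | mul f g _ _ hf hg => rw [star_mul]; exact Subalgebra.mul_mem _ hg hf }

theorem exp_ridge_apply (c : EuclideanSpace ℝ (Fin n)) (x : Sph n) :
    NormedSpace.exp (ridge c 1) x =
      Complex.exp ((inner ℝ c (x : EuclideanSpace ℝ (Fin n)) : ℝ) : ℂ) := by
  have := NormedSpace.map_exp (ContinuousMap.evalAlgHom ℂ ℂ x)
    (continuous_eval_const x) (ridge c 1)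
  rw [Complex.exp_eq_exp_ℂ]
  simpa [ridge_apply] using this

theorem separatesPoints_expAlgebra : (expAlgebra n).SeparatesPoints := by
  intro x y hxy
  refine ⟨_, ⟨NormedSpace.exp (ridge ((x : EuclideanSpace ℝ (Fin n)) - y) 1),
    Algebra.subset_adjoin ⟨_, rfl⟩, rfl⟩, ?_⟩
  change NormedSpace.exp (ridge _ 1) x ≠ NormedSpace.exp (ridge _ 1) y
  rw [exp_ridge_apply, exp_ridge_apply, ← Complex.ofReal_exp, ← Complex.ofReal_exp, Ne,
    Complex.ofReal_inj, Real.exp_eq_exp, ← sub_eq_zero, ← inner_sub_right, inner_self_eq_zero,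
    sub_eq_zero]
  exact fun h => hxy (Subtype.ext h)

/-- Exponentials of linear forms are closed under multiplication, so the algebra is merely their
span; each one is a limit of sums of powers of a linear form. Products of different ridge functions
never have to be decomposed. -/
theorem expAlgebra_le (hn : 2 ≤ n) :
    (expAlgebra n).toSubalgebra.toSubmodule ≤ (⨆ i, harmSpace n i).topologicalClosure := by
  change Subalgebra.toSubmodule (Algebra.adjoin ℂ _) ≤ _
  rw [Algebra.adjoin_eq_span, Submodule.span_le]
  intro f hf
  have : ∃ c : EuclideanSpace ℝ (Fin n), f = NormedSpace.exp (ridge c 1) := by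
    induction hf using Submonoid.closure_induction with
    | mem f hf => obtain ⟨c, rfl⟩ := hf; exact ⟨c, rfl⟩
    | one =>
      refine ⟨0, ?_⟩
      have : ridge (0 : EuclideanSpace ℝ (Fin n)) 1 = 0 := by ext x; simp [ridge_apply]
      rw [this, NormedSpace.exp_zero]
    | mul f g _ _ hf hg =>
      obtain ⟨c, rfl⟩ := hf
      obtain ⟨d, rfl⟩ := hg
      refine ⟨c + d, ?_⟩
      have : ridge (c + d) 1 = ridge c 1 + ridge d 1 := by
        ext x; simp [ridge_apply, inner_add_left]
      rw [this, NormedSpace.exp_add]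
  obtain ⟨c, rfl⟩ := this
  have hs := NormedSpace.exp_series_hasSum_exp' (𝕂 := ℂ) (ridge c 1)
  refine mem_closure_of_tendsto hs (Filter.Eventually.of_forall fun s => ?_)
  refine Submodule.sum_mem _ fun j _ => Submodule.smul_mem _ _ ?_
  rw [ridge_one_pow]
  exact ridge_mem_iSup hn c j

theorem topologicalClosure_iSup_harmSpace (hn : 2 ≤ n) :
    (⨆ i, harmSpace n i).topologicalClosure = ⊤ := by
  have h := ContinuousMap.starSubalgebra_topologicalClosure_eq_top_of_separatesPoints
    (expAlgebra n) separatesPoints_expAlgebra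
  rw [eq_top_iff]
  intro f _
  have hf : f ∈ (expAlgebra n).topologicalClosure := by rw [h]; trivial
  exact closure_minimal (expAlgebra_le hn) (Submodule.isClosed_topologicalClosure _) hf

end Harmonics

/-! ### Operators with compact resolvent -/

section Resolvent

variable {H : Type*} [NormedAddCommGroup H] [InnerProductSpace ℂ H]

theorem re_inner_self (x : H) : (inner ℂ x x).re = ‖x‖ ^ 2 := inner_self_eq_norm_sq (𝕜 := ℂ) x

/-- This is `T² ≤ ‖T‖ T`, obtained by testing positivity of `T` on `h - ‖T‖⁻¹ T h`. -/
theorem norm_sq_apply_le {T : H →L[ℂ] H} (hs : T.IsSymmetric)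
    (hpos : ∀ x, 0 ≤ (inner ℂ (T x) x).re) (h0 : T ≠ 0) (h : H) :
    ‖T‖⁻¹ * ‖T h‖ ^ 2 ≤ (inner ℂ (T h) h).re := by
  have hτ : 0 < ‖T‖ := norm_pos_iff.mpr h0
  have h1 := hpos (h - ((‖T‖⁻¹ : ℝ) : ℂ) • T h)
  have h2 : (inner ℂ (T (T h)) (T h)).re ≤ ‖T‖ * ‖T h‖ ^ 2 := by
    refine (Complex.re_le_norm _).trans ((norm_inner_le_norm _ _).trans ?_)
    calc ‖T (T h)‖ * ‖T h‖ ≤ (‖T‖ * ‖T h‖) * ‖T h‖ := by gcongr; exact T.le_opNorm _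
      _ = _ := by ring
  have h3 : inner ℂ (T (T h)) h = inner ℂ (T h) (T h) := hs (T h) h
  rw [map_sub, map_smul, inner_sub_left, inner_sub_right, inner_sub_right, inner_smul_left,
    inner_smul_left, inner_smul_right, inner_smul_right, h3, inner_self_eq_norm_sq_to_K,
    Complex.conj_ofReal] at h1
  have h4 : (((‖T h‖ : ℝ) : ℂ) ^ 2).re = ‖T h‖ ^ 2 := by
    rw [← Complex.ofReal_pow, Complex.ofReal_re]
  simp only [Complex.sub_re, Complex.re_ofReal_mul, Complex.coe_algebraMap, h4] at h1
  have h5 : ‖T‖⁻¹ * (‖T‖⁻¹ * (inner ℂ (T (T h)) (T h)).re) ≤ ‖T‖⁻¹ * ‖T h‖ ^ 2 := by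
    calc _ ≤ ‖T‖⁻¹ * (‖T‖⁻¹ * (‖T‖ * ‖T h‖ ^ 2)) := by gcongr
      _ = _ := by field_simp
  linarith

theorem isCompactOperator_of_finiteDimensional_range {T : H →L[ℂ] H} (V : Submodule ℂ H)
    [FiniteDimensional ℂ V] (h : ∀ x, T x ∈ V) : IsCompactOperator T := by
  have : ProperSpace V := FiniteDimensional.proper ℂ V
  have h1 : IsCompactOperator (T.codRestrict V h) := by
    have := (isCompactOperator_id (E := V)).comp_clm (T.codRestrict V h)
    simpa using this
  exact h1.clm_comp V.subtypeL

variable [CompleteSpace H]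

/-- The top of the numerical range of a nonzero compact nonnegative operator is an eigenvalue. -/
theorem exists_eigenvector_norm [Nontrivial H] {T : H →L[ℂ] H} (hT : IsCompactOperator T)
    (hs : T.IsSymmetric) (hpos : ∀ x, 0 ≤ (inner ℂ (T x) x).re) (h0 : T ≠ 0) :
    ∃ f ≠ 0, T f = (‖T‖ : ℂ) • f := by
  have hτ : (‖T‖ : ℂ) ≠ 0 := by
    exact_mod_cast norm_ne_zero_iff.mpr h0
  -- Fredholm alternative at `‖T‖`: in the resolvent set the Rayleigh quotients would stay below
  -- `‖T‖ - ε`, although their supremum is `‖T‖`.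
  rcases hT.hasEigenvalue_or_mem_resolventSet hτ with h | h
  · obtain ⟨f, hf⟩ := h.exists_hasEigenvector
    exact ⟨f, hf.2, hf.apply_eq_smul⟩
  · obtain ⟨ε, hε, hle⟩ := T.rayleighQuotient_le_of_norm_mem_resolventSet h
    have h1 : ‖T‖ ≤ ‖T‖ - ε := by
      conv_lhs => rw [T.norm_eq_iSup_rayleighQuotient hs]
      refine ciSup_le fun x => ?_
      rw [abs_of_nonneg]
      · exact hle x
      · exact div_nonneg (hpos x) (by positivity)
    linarith

/-- If `R` is the resolvent `(D + c)⁻¹` of a nonnegative operator with compact resolvent, then the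
perturbation `D + γ X` by a symmetric contraction, `|γ| < c`, has a lowest eigenvalue, which is the
minimum of its quadratic form. -/
theorem exists_ground_state [Nontrivial H] {R X : H →L[ℂ] H} {c γ : ℝ}
    (hRs : R.IsSymmetric) (hRc : IsCompactOperator R)
    (hRpos : ∀ u, c * ‖R u‖ ^ 2 ≤ (inner ℂ (R u) u).re) (hR0 : R ≠ 0)
    (hXs : X.IsSymmetric) (hX : ‖X‖ ≤ 1) (hγ : |γ| < c) :
    ∃ l : ℝ, (∃ f ≠ 0, f = R ((l : ℂ) • f + (c : ℂ) • f - (γ : ℂ) • X f)) ∧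
      ∀ f g, f = R (g + (c : ℂ) • f - (γ : ℂ) • X f) → l * ‖f‖ ^ 2 ≤ (inner ℂ f g).re := by
  have hc : 0 < c := (abs_nonneg γ).trans_lt hγ
  have hRn : ‖R‖ ≤ c⁻¹ := by
    refine R.opNorm_le_bound (by positivity) fun u => ?_
    have h1 := (hRpos u).trans ((Complex.re_le_norm _).trans (norm_inner_le_norm _ _))
    rcases (norm_nonneg (R u)).eq_or_lt with h | h
    · rw [← h]; positivity
    · rw [inv_mul_eq_div, le_div_iff₀ hc]
      nlinarith
  -- As `‖R‖ ≤ 1/c` and `|γ| < c`, the Neumann series inverts `B = 1 + γ X R`.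
  have hXR : ‖-((γ : ℂ) • (X * R))‖ < 1 := by
    rw [norm_neg, norm_smul, Complex.norm_real, Real.norm_eq_abs]
    calc |γ| * ‖X * R‖ ≤ |γ| * (1 * c⁻¹) := by
          gcongr
          exact (norm_mul_le X R).trans (mul_le_mul hX hRn (norm_nonneg _) zero_le_one)
      _ < 1 := by rw [one_mul, ← div_eq_mul_inv, div_lt_one hc]; exact hγ
  set B := Units.oneSub _ hXR with hB
  have hBv : ∀ u, (B : H →L[ℂ] H) u = u + (γ : ℂ) • X (R u) := by
    intro u
    simp [hB]
  have hBi : ∀ h, (B : H →L[ℂ] H) ((↑B⁻¹ : H →L[ℂ] H) h) = h := fun h => by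
    rw [← mul_apply_eq_comp, B.mul_inv, one_apply_eq_self]
  have hBi' : ∀ h, (↑B⁻¹ : H →L[ℂ] H) ((B : H →L[ℂ] H) h) = h := fun h => by
    rw [← mul_apply_eq_comp, B.inv_mul, one_apply_eq_self]
  -- `T = R B⁻¹` is the resolvent `(D + γ X + c)⁻¹`. Writing vectors as `B u` reduces its symmetry
  -- and positivity to those of `R + γ R X R`.
  set T : H →L[ℂ] H := R ∘L (↑B⁻¹ : H →L[ℂ] H) with hT
  have hTB : ∀ u, T ((B : H →L[ℂ] H) u) = R u := fun u => by
    rw [hT, ContinuousLinearMap.comp_apply, hBi']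
  have hTs : T.IsSymmetric := by
    intro h k
    obtain ⟨u, rfl⟩ : ∃ u, h = (B : H →L[ℂ] H) u := ⟨_, (hBi h).symm⟩
    obtain ⟨v, rfl⟩ : ∃ v, k = (B : H →L[ℂ] H) v := ⟨_, (hBi k).symm⟩
    change inner ℂ (T _) _ = inner ℂ _ (T _)
    have e1 : inner ℂ (R u) v = inner ℂ u (R v) := hRs u v
    have e2 : inner ℂ (X (R u)) (R v) = inner ℂ (R u) (X (R v)) := hXs _ _
    rw [hTB, hTB, hBv, hBv, inner_add_left, inner_add_right, inner_smul_left, inner_smul_right,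
      e1, e2, Complex.conj_ofReal]
  have hTpos : ∀ h, 0 ≤ (inner ℂ (T h) h).re := by
    intro h
    obtain ⟨u, rfl⟩ : ∃ u, h = (B : H →L[ℂ] H) u := ⟨_, (hBi h).symm⟩
    rw [hTB, hBv, inner_add_right, inner_smul_right, Complex.add_re, Complex.re_ofReal_mul]
    have h1 := hRpos u
    have h2 : |γ * (inner ℂ (R u) (X (R u))).re| ≤ c * ‖R u‖ ^ 2 := by
      rw [abs_mul, sq]
      refine mul_le_mul hγ.le ((Complex.abs_re_le_norm _).trans ((norm_inner_le_norm _ _).trans ?_))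
        (abs_nonneg _) hc.le
      gcongr
      exact (X.le_opNorm _).trans (mul_le_of_le_one_left (norm_nonneg _) hX)
    have := neg_le_of_abs_le h2
    linarith
  have hT0 : T ≠ 0 := by
    intro h
    apply hR0
    ext u
    rw [← hTB, h]
    simp
  have hTc : IsCompactOperator T := hRc.comp_clm _
  have hτ : 0 < ‖T‖ := norm_pos_iff.mpr hT0
  -- The largest eigenvalue `‖T‖` of the resolvent corresponds to the lowest one, `‖T‖⁻¹ - c`, of `D
  -- + γ X`.
  refine ⟨‖T‖⁻¹ - c, ?_, fun f g hfg => ?_⟩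
  · obtain ⟨f, hf0, hf⟩ := exists_eigenvector_norm hTc hTs hTpos hT0
    refine ⟨f, hf0, ?_⟩
    have hτ' : (‖T‖ : ℂ) ≠ 0 := by exact_mod_cast hτ.ne'
    obtain ⟨u, rfl⟩ : ∃ u, f = (B : H →L[ℂ] H) u := ⟨_, (hBi f).symm⟩
    rw [hTB] at hf
    set f := (B : H →L[ℂ] H) u with hfdef
    have h1 : f = u + (γ : ℂ) • X ((‖T‖ : ℂ) • f) := by rw [← hf, ← hBv]
    have h2 : ((‖T‖⁻¹ - c : ℝ) : ℂ) • f + (c : ℂ) • f - (γ : ℂ) • X f = (‖T‖ : ℂ)⁻¹ • u := by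
      have h3 : u = f - (γ : ℂ) • X ((‖T‖ : ℂ) • f) := eq_sub_of_add_eq h1.symm
      rw [h3, ← add_smul, map_smul, smul_sub, smul_comm (γ : ℂ), smul_smul, inv_mul_cancel₀ hτ',
        one_smul]
      push_cast
      rw [sub_add_cancel]
    rw [h2, map_smul, hf, smul_smul, inv_mul_cancel₀ hτ', one_smul]
  · have h1 : T (g + (c : ℂ) • f) = f := by
      have : g + (c : ℂ) • f = (B : H →L[ℂ] H) (g + (c : ℂ) • f - (γ : ℂ) • X f) := by
        rw [hBv, ← hfg]
        abel
      rw [this, hTB, ← hfg]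
    -- Since `T (g + c f) = f`, this reads `‖T‖⁻¹ ‖f‖² ≤ Re ⟨f, g + c f⟩`.
    have h2 := norm_sq_apply_le hTs hTpos hT0 (g + (c : ℂ) • f)
    rw [h1, inner_add_right, inner_smul_right, Complex.add_re, Complex.re_ofReal_mul,
      re_inner_self] at h2
    linarith

/-- The operator `∑ (ν_k + c)⁻¹ P_k`, where `P_k` is the orthogonal projection onto `E k`. -/
def diagResolvent (E : ℕ → Submodule ℂ H) [∀ k, FiniteDimensional ℂ (E k)] (ν : ℕ → ℝ) (c : ℝ) :
    H →L[ℂ] H :=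
  ∑' k, (((ν k + c)⁻¹ : ℝ) : ℂ) • (E k).starProjection

variable {E : ℕ → Submodule ℂ H} [∀ k, FiniteDimensional ℂ (E k)] {ν : ℕ → ℝ} {c : ℝ}

/-- Convergence in operator norm, so that compactness passes from the finite-rank partial sums to
the limit. -/
theorem hasSum_diagResolvent (hν : ∀ k : ℕ, (k : ℝ) ^ 2 ≤ ν k) (hc : 1 ≤ c) :
    HasSum (fun k => (((ν k + c)⁻¹ : ℝ) : ℂ) • (E k).starProjection) (diagResolvent E ν c) := by
  refine Summable.hasSum ?_
  -- The majorant comes from `(k+1)² ≤ 2(k²+1)`.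
  have hsum : Summable fun k : ℕ => 2 * (((k + 1 : ℕ) : ℝ) ^ 2)⁻¹ :=
    ((summable_nat_add_iff 1).mpr (Real.summable_nat_pow_inv.mpr one_lt_two)).mul_left 2
  refine Summable.of_norm_bounded hsum fun k => ?_
  have h1 : 0 < ν k + c := by have := hν k; have := sq_nonneg (k : ℝ); linarith
  rw [norm_smul, Complex.norm_real, Real.norm_of_nonneg (by positivity)]
  calc (ν k + c)⁻¹ * ‖(E k).starProjection‖ ≤ (ν k + c)⁻¹ * 1 := by
        gcongr; exact Submodule.starProjection_norm_le _
    _ ≤ 2 * (((k + 1 : ℕ) : ℝ) ^ 2)⁻¹ := by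
        rw [mul_one, ← div_eq_mul_inv, inv_eq_one_div, div_le_div_iff₀ h1 (by positivity)]
        push_cast
        nlinarith [hν k, sq_nonneg ((k : ℝ) - 1)]

theorem hasSum_diagResolvent_apply (hν : ∀ k : ℕ, (k : ℝ) ^ 2 ≤ ν k) (hc : 1 ≤ c) (u : H) :
    HasSum (fun k => (((ν k + c)⁻¹ : ℝ) : ℂ) • (E k).starProjection u) (diagResolvent E ν c u) :=
  (hasSum_diagResolvent (E := E) hν hc).mapL (ContinuousLinearMap.apply ℂ H u)

theorem diagResolvent_apply_of_mem (hO : Pairwise fun i j => E i ⟂ E j)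
    (hν : ∀ k : ℕ, (k : ℝ) ^ 2 ≤ ν k) (hc : 1 ≤ c) {j : ℕ} {e : H} (he : e ∈ E j) :
    diagResolvent E ν c e = (((ν j + c)⁻¹ : ℝ) : ℂ) • e := by
  refine (hasSum_diagResolvent_apply hν hc e).unique ?_
  have h : (((ν j + c)⁻¹ : ℝ) : ℂ) • e = (((ν j + c)⁻¹ : ℝ) : ℂ) • (E j).starProjection e := by
    rw [Submodule.starProjection_eq_self_iff.mpr he]
  rw [h]
  refine hasSum_single j fun k hk => ?_
  rw [(Submodule.starProjection_apply_eq_zero_iff (E k)).mpr ((hO hk.symm).le he), smul_zero]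

theorem isSymmetric_diagResolvent (hν : ∀ k : ℕ, (k : ℝ) ^ 2 ≤ ν k) (hc : 1 ≤ c) :
    (diagResolvent E ν c).IsSymmetric := by
  intro u v
  have h1 := (hasSum_diagResolvent_apply (E := E) hν hc v).mapL (innerSL ℂ u)
  have h2 := (hasSum_diagResolvent_apply (E := E) hν hc u).mapL (innerSL ℂ v)
  have h3 := h2.mapL (Complex.conjCLE : ℂ →L[ℝ] ℂ)
  refine HasSum.unique (L := .unconditional ℕ) (f := fun k => (((ν k + c)⁻¹ : ℝ) : ℂ) *
    inner ℂ u ((E k).starProjection v)) ?_ ?_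
  · convert h3 using 1
    · ext k
      simp only [innerSL_apply_apply, inner_smul_right, ContinuousLinearEquiv.coe_coe,
        Complex.conjCLE_apply, map_mul, Complex.conj_ofReal, inner_conj_symm]
      rw [Submodule.inner_starProjection_left_eq_right]
    · simp
  · simp only [innerSL_apply_apply, inner_smul_right] at h1
    exact h1

theorem isCompactOperator_diagResolvent (hν : ∀ k : ℕ, (k : ℝ) ^ 2 ≤ ν k) (hc : 1 ≤ c) :
    IsCompactOperator (diagResolvent E ν c) := by
  refine isCompactOperator_of_tendsto (hasSum_diagResolvent (E := E) hν hc)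
    (Filter.Eventually.of_forall fun s => ?_)
  refine Submodule.sum_mem (compactOperator (RingHom.id ℂ) H H) fun k _ => ?_
  exact Submodule.smul_mem _ _ (isCompactOperator_of_finiteDimensional_range (E k)
    fun x => (E k).starProjection_apply_mem x)

/-- Both sides are series in `⟨u, P_k u⟩ ≥ 0`, with coefficients `c (ν_k + c)⁻²` and `(ν_k + c)⁻¹`;
the comparison is termwise because `ν_k ≥ 0`. -/
theorem le_re_inner_diagResolvent (hO : Pairwise fun i j => E i ⟂ E j)
    (hν : ∀ k : ℕ, (k : ℝ) ^ 2 ≤ ν k) (hc : 1 ≤ c) (u : H) :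
    c * ‖diagResolvent E ν c u‖ ^ 2 ≤ (inner ℂ (diagResolvent E ν c u) u).re := by
  have hs : ∀ a b, inner ℂ (diagResolvent E ν c a) b = inner ℂ a (diagResolvent E ν c b) :=
    isSymmetric_diagResolvent hν hc
  have key : ∀ v, HasSum (fun k => (ν k + c)⁻¹ * (inner ℂ v ((E k).starProjection u)).re)
      (inner ℂ v (diagResolvent E ν c u)).re := by
    intro v
    have h1 := ((hasSum_diagResolvent_apply (E := E) hν hc u).mapL (innerSL ℂ v)).mapL
      Complex.reCLM
    convert h1 using 1
    · ext k
      rw [innerSL_apply_apply, inner_smul_right, Complex.reCLM_apply, Complex.re_ofReal_mul]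
    · rfl
  have h1 := key u
  have h2 := (key (diagResolvent E ν c u)).mul_left c
  rw [re_inner_self] at h2
  rw [hs]
  refine hasSum_le (fun k => ?_) h2 h1
  have hk : 0 ≤ ν k := (sq_nonneg _).trans (hν k)
  have hp : 0 ≤ (inner ℂ u ((E k).starProjection u)).re := by
    rw [← Submodule.inner_starProjection_left_eq_right]
    exact Submodule.re_inner_starProjection_nonneg (K := E k) u
  rw [hs, diagResolvent_apply_of_mem hO hν hc ((E k).starProjection_apply_mem u), inner_smul_right,
    Complex.re_ofReal_mul]
  have h4 : c * (ν k + c)⁻¹ ≤ 1 := by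
    rw [← div_eq_mul_inv, div_le_one (by linarith)]
    linarith
  have h5 : 0 ≤ (ν k + c)⁻¹ * (inner ℂ u ((E k).starProjection u)).re :=
    mul_nonneg (inv_nonneg.mpr (by linarith)) hp
  nlinarith

end Resolvent

/-! ### The angular operator in `L²` of the sphere -/

section SphereOperator

variable {n : ℕ}

/-- The north pole. -/
def northPole (n : ℕ) : EuclideanSpace ℝ (Fin n) :=
  if h : 0 < n then EuclideanSpace.single ⟨n - 1, Nat.sub_lt h one_pos⟩ 1 else 0

theorem norm_northPole (hn : 0 < n) : ‖northPole n‖ = 1 := by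
  simp [northPole, hn]

theorem ridge_northPole_one (x : Sph n) : ridge (northPole n) 1 x = (cosTheta x : ℂ) := by
  rw [ridge_apply, pow_one, northPole, cosTheta]
  split_ifs with h
  · simp [EuclideanSpace.inner_single_left]
  · simp

theorem continuous_cosTheta : Continuous (cosTheta (n := n)) := by
  have h : cosTheta (n := n) = fun x => (ridge (northPole n) 1 x).re := by
    ext x
    rw [ridge_northPole_one, Complex.ofReal_re]
  rw [h]
  fun_prop

theorem abs_cosTheta_le_one (x : Sph n) : |cosTheta x| ≤ 1 := by
  rw [cosTheta]
  split_ifs with h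
  · have := PiLp.norm_apply_le (x : EuclideanSpace ℝ (Fin n)) ⟨n - 1, Nat.sub_lt h one_pos⟩
    rwa [sph_norm] at this
  · simp

theorem memLp_cosTheta_mul (f : Lp ℂ 2 (surfaceMeasure n)) :
    MemLp (fun x => (cosTheta x : ℂ) * f x) 2 (surfaceMeasure n) := by
  refine (Lp.memLp f).of_le ?_ (Filter.Eventually.of_forall fun x => ?_)
  · exact (Complex.continuous_ofReal.comp continuous_cosTheta).aestronglyMeasurable.mul
      (Lp.aestronglyMeasurable f)
  · rw [norm_mul, Complex.norm_real]
    exact mul_le_of_le_one_left (norm_nonneg _) (abs_cosTheta_le_one x)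

/-- Multiplication by `cos θ_{n-1}` in `L²(S^{n-1})`. -/
def cosMul (n : ℕ) : Lp ℂ 2 (surfaceMeasure n) →L[ℂ] Lp ℂ 2 (surfaceMeasure n) :=
  LinearMap.mkContinuous
    { toFun := fun f => (memLp_cosTheta_mul f).toLp
      map_add' := fun f g => by
        refine Lp.ext ?_
        filter_upwards [(memLp_cosTheta_mul (f + g)).coeFn_toLp, (memLp_cosTheta_mul f).coeFn_toLp,
          (memLp_cosTheta_mul g).coeFn_toLp, Lp.coeFn_add f g,
          Lp.coeFn_add (memLp_cosTheta_mul f).toLp (memLp_cosTheta_mul g).toLp]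
          with x h1 h2 h3 h4 h5
        rw [h1, h5, Pi.add_apply, h2, h3, h4, Pi.add_apply, mul_add]
      map_smul' := fun c f => by
        refine Lp.ext ?_
        filter_upwards [(memLp_cosTheta_mul (c • f)).coeFn_toLp, (memLp_cosTheta_mul f).coeFn_toLp,
          Lp.coeFn_smul c f, Lp.coeFn_smul c (memLp_cosTheta_mul f).toLp] with x h1 h2 h3 h4
        rw [h1, RingHom.id_apply, h4, Pi.smul_apply, h2, h3, Pi.smul_apply, smul_eq_mul,
          smul_eq_mul, mul_left_comm] }
    1 fun f => by
      rw [one_mul]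
      refine Lp.norm_le_norm_of_ae_le ?_
      filter_upwards [(memLp_cosTheta_mul f).coeFn_toLp] with x h1
      change ‖((memLp_cosTheta_mul f).toLp _) x‖ ≤ _
      rw [h1, norm_mul, Complex.norm_real]
      exact mul_le_of_le_one_left (norm_nonneg _) (abs_cosTheta_le_one x)

theorem coeFn_cosMul (f : Lp ℂ 2 (surfaceMeasure n)) :
    cosMul n f =ᵐ[surfaceMeasure n] fun x => (cosTheta x : ℂ) * f x :=
  (memLp_cosTheta_mul f).coeFn_toLp

theorem norm_cosMul_le : ‖cosMul n‖ ≤ 1 := LinearMap.mkContinuous_norm_le _ zero_le_one _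

theorem isSymmetric_cosMul : (cosMul n).IsSymmetric := by
  intro f g
  change inner ℂ (cosMul n f) g = inner ℂ f (cosMul n g)
  rw [L2.inner_def, L2.inner_def]
  refine integral_congr_ae ?_
  filter_upwards [coeFn_cosMul f, coeFn_cosMul g] with x h1 h2
  rw [h1, h2]
  simp only [RCLike.inner_apply, map_mul, Complex.conj_ofReal]
  ring

/-- The inclusion of the continuous functions into `L²(S^{n-1})`. -/
abbrev toL2 (n : ℕ) : C(Sph n, ℂ) →L[ℂ] Lp ℂ 2 (surfaceMeasure n) :=
  ContinuousMap.toLp 2 (surfaceMeasure n) ℂ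

theorem coeFn_toL2 (u : C(Sph n, ℂ)) : toL2 n u =ᵐ[surfaceMeasure n] u :=
  ContinuousMap.coeFn_toLp (𝕜 := ℂ) (surfaceMeasure n) u

theorem toL2_injective : Function.Injective (toL2 n) :=
  ContinuousMap.toLp_injective (𝕜 := ℂ) (surfaceMeasure n)

theorem cosMul_toL2 (u : C(Sph n, ℂ)) :
    cosMul n (toL2 n u) = toL2 n (ridge (northPole n) 1 * u) := by
  refine Lp.ext ?_
  filter_upwards [coeFn_cosMul (toL2 n u), coeFn_toL2 u, coeFn_toL2 (ridge (northPole n) 1 * u)]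
    with x h1 h2 h3
  rw [h1, h2, h3, ContinuousMap.mul_apply, ridge_northPole_one]

/-- The spherical harmonics of degree `k`, as a subspace of `L²(S^{n-1})`. -/
def harmL2 (n k : ℕ) : Submodule ℂ (Lp ℂ 2 (surfaceMeasure n)) :=
  (harmSpace n k).map (toL2 n : C(Sph n, ℂ) →ₗ[ℂ] Lp ℂ 2 (surfaceMeasure n))

instance finiteDimensional_harmL2 (k : ℕ) : FiniteDimensional ℂ (harmL2 n k) := by
  unfold harmL2
  infer_instance

theorem topologicalClosure_iSup_harmL2 (hn : 2 ≤ n) :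
    (⨆ k, harmL2 n k).topologicalClosure = ⊤ := by
  have h1 : (⨆ k, harmL2 n k) =
      (⨆ k, harmSpace n k).map (toL2 n : C(Sph n, ℂ) →ₗ[ℂ] Lp ℂ 2 (surfaceMeasure n)) := by
    rw [Submodule.map_iSup]
    rfl
  have h2 : Dense ((⨆ k, harmSpace n k : Submodule ℂ C(Sph n, ℂ)) : Set C(Sph n, ℂ)) := by
    rw [Submodule.dense_iff_topologicalClosure_eq_top]
    exact topologicalClosure_iSup_harmSpace hn
  have h3 : DenseRange (toL2 n) := ContinuousMap.toLp_denseRange ℂ _ ℂ (by norm_num)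
  rw [← Submodule.dense_iff_topologicalClosure_eq_top, h1]
  exact h3.dense_image (toL2 n).continuous h2

/-- Green's identity with the conjugate of `u`. It yields both the orthogonality of eigenfunctions
and the action of the resolvent on smooth functions. -/
theorem inner_eigenfunction_eq [Nontrivial (EuclideanSpace ℝ (Fin n))] {ν : ℝ} {u : C(Sph n, ℂ)}
    (hsu : IsSmoothOnSphere u) (hu : laplaceBeltrami u = (-(ν : ℂ)) • ⇑u) {φ : Sph n → ℂ}
    (hφ : IsSmoothOnSphere φ)
    {f g : Lp ℂ 2 (surfaceMeasure n)} (hf : f =ᵐ[surfaceMeasure n] φ)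
    (hg : g =ᵐ[surfaceMeasure n] -laplaceBeltrami φ) :
    inner ℂ (toL2 n u) g = (ν : ℂ) * inner ℂ (toL2 n u) f := by
  rw [← inner_smul_right, ← sub_eq_zero, ← inner_sub_right, L2.inner_def]
  rw [← neg_eq_zero, ← integral_laplaceBeltrami_mul_sub hφ hsu.star, ← integral_neg]
  refine integral_congr_ae ?_
  filter_upwards [coeFn_toL2 u, hf, hg, Lp.coeFn_sub g ((ν : ℂ) • f),
    Lp.coeFn_smul (ν : ℂ) f] with x h1 h2 h3 h4 h5
  rw [laplaceBeltrami_star, h4, Pi.sub_apply, h5, Pi.smul_apply, h1, h2, h3, hu]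
  simp only [Pi.neg_apply, Pi.star_apply, Pi.smul_apply, smul_eq_mul, RCLike.inner_apply,
    RCLike.star_def, map_mul, map_neg, Complex.conj_ofReal]
  ring

theorem eigenfunction_smul_ae_eq {ν : ℝ} {u : C(Sph n, ℂ)}
    (hu : laplaceBeltrami u = (-(ν : ℂ)) • ⇑u) :
    ((ν : ℂ) • toL2 n u : Lp ℂ 2 (surfaceMeasure n)) =ᵐ[surfaceMeasure n]
      -laplaceBeltrami u := by
  filter_upwards [coeFn_toL2 u, Lp.coeFn_smul (ν : ℂ) (toL2 n u)] with x h1 h2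
  rw [h2, Pi.smul_apply, h1, hu]
  simp

theorem pairwise_isOrtho_harmL2 (hn : 2 ≤ n) : Pairwise fun i j => harmL2 n i ⟂ harmL2 n j := by
  have : Nontrivial (EuclideanSpace ℝ (Fin n)) := by
    have : Nonempty (Fin n) := ⟨⟨0, by omega⟩⟩
    infer_instance
  intro i j hij
  rw [Submodule.isOrtho_iff_inner_eq]
  rintro _ ⟨u, hu, rfl⟩ _ ⟨v, hv, rfl⟩
  change inner ℂ (toL2 n u) (toL2 n v) = 0
  have h1 := inner_eigenfunction_eq (isSmoothOnSphere_of_mem_harmSpace hu) hu.2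
    (isSmoothOnSphere_of_mem_harmSpace hv) (coeFn_toL2 v)
    (eigenfunction_smul_ae_eq hv.2)
  rw [inner_smul_right, ← sub_eq_zero, ← sub_mul] at h1
  refine (mul_eq_zero.mp h1).resolve_left ?_
  refine sub_ne_zero.mpr ?_
  exact_mod_cast (sphEigenvalue_strictMono hn).injective.ne hij.symm

/-! ### The graph of the operator and its closure -/

theorem dipoleExpression_add (γ : ℝ) {φ ψ : Sph n → ℂ} (hφ : IsSmoothOnSphere φ)
    (hψ : IsSmoothOnSphere ψ) :
    dipoleExpression γ (φ + ψ) = dipoleExpression γ φ + dipoleExpression γ ψ := by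
  ext x
  simp only [dipoleExpression, laplaceBeltrami_add hφ hψ, Pi.add_apply]
  ring

theorem dipoleExpression_const_smul (γ : ℝ) {φ : Sph n → ℂ} (hφ : IsSmoothOnSphere φ) (c : ℂ) :
    dipoleExpression γ (c • φ) = c • dipoleExpression γ φ := by
  ext x
  simp only [dipoleExpression, laplaceBeltrami_const_smul hφ, Pi.smul_apply, smul_eq_mul]
  ring

theorem isSmoothOnSphere_zero : IsSmoothOnSphere (0 : Sph n → ℂ) := by
  have h := (isSmoothOnSphere_ridge (0 : EuclideanSpace ℝ (Fin n)) 0).const_smul 0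
  rwa [zero_smul] at h

/-- `smoothDipoleGraph` as a subspace. -/
def smoothDipoleSubmodule (n : ℕ) (γ : ℝ) :
    Submodule ℂ (Lp ℂ 2 (surfaceMeasure n) × Lp ℂ 2 (surfaceMeasure n)) where
  carrier := smoothDipoleGraph n γ
  add_mem' := by
    rintro p q ⟨φ, hφ, h1, h2⟩ ⟨ψ, hψ, h3, h4⟩
    refine ⟨φ + ψ, hφ.add hψ, (Lp.coeFn_add _ _).trans (h1.add h3), ?_⟩
    rw [dipoleExpression_add γ hφ hψ]
    exact (Lp.coeFn_add _ _).trans (h2.add h4)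
  zero_mem' := by
    refine ⟨0, isSmoothOnSphere_zero, Lp.coeFn_zero _ _ _, ?_⟩
    have h := dipoleExpression_const_smul γ (isSmoothOnSphere_zero (n := n)) 0
    rw [zero_smul, zero_smul] at h
    rw [h]
    exact Lp.coeFn_zero _ _ _
  smul_mem' := by
    rintro c p ⟨φ, hφ, h1, h2⟩
    refine ⟨c • φ, hφ.const_smul c, (Lp.coeFn_smul _ _).trans (h1.const_smul c), ?_⟩
    rw [dipoleExpression_const_smul γ hφ]
    exact (Lp.coeFn_smul _ _).trans (h2.const_smul c)

theorem mem_smoothDipoleGraph_of_laplaceBeltrami {φ : Sph n → ℂ} (hφ : IsSmoothOnSphere φ) (γ : ℝ)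
    {f g : Lp ℂ 2 (surfaceMeasure n)} (hf : f =ᵐ[surfaceMeasure n] φ)
    (hg : g =ᵐ[surfaceMeasure n] -laplaceBeltrami φ) :
    (f, g + (γ : ℂ) • cosMul n f) ∈ smoothDipoleGraph n γ := by
  refine ⟨φ, hφ, hf, ?_⟩
  filter_upwards [hf, hg, coeFn_cosMul f, Lp.coeFn_add g ((γ : ℂ) • cosMul n f),
    Lp.coeFn_smul (γ : ℂ) (cosMul n f)] with x h1 h2 h3 h4 h5
  rw [h4, Pi.add_apply, h5, Pi.smul_apply, h2, h3, h1, dipoleExpression, Pi.neg_apply, smul_eq_mul]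
  push_cast
  ring

theorem exists_of_mem_smoothDipoleGraph {γ : ℝ} {f g : Lp ℂ 2 (surfaceMeasure n)}
    (h : (f, g) ∈ smoothDipoleGraph n γ) :
    ∃ φ, IsSmoothOnSphere φ ∧ f =ᵐ[surfaceMeasure n] φ ∧
      (g - (γ : ℂ) • cosMul n f : Lp ℂ 2 (surfaceMeasure n)) =ᵐ[surfaceMeasure n]
        -laplaceBeltrami φ := by
  obtain ⟨φ, hφ, hf, hg⟩ := h
  refine ⟨φ, hφ, hf, ?_⟩
  filter_upwards [hf, hg, coeFn_cosMul f, Lp.coeFn_sub g ((γ : ℂ) • cosMul n f),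
    Lp.coeFn_smul (γ : ℂ) (cosMul n f)] with x h1 h2 h3 h4 h5
  rw [h4, Pi.sub_apply, h5, Pi.smul_apply, h2, h3, h1, dipoleExpression, Pi.neg_apply, smul_eq_mul]
  push_cast
  ring

/-- The potential is bounded, so changing `γ` shears the graph by a continuous map, which commutes
with taking closures. -/
theorem mem_dipoleGraph_shift {γ : ℝ} (γ' : ℝ) {f g : Lp ℂ 2 (surfaceMeasure n)}
    (h : (f, g) ∈ dipoleGraph n γ) :
    (f, g + ((γ' - γ : ℝ) : ℂ) • cosMul n f) ∈ dipoleGraph n γ' := by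
  refine map_mem_closure (f := fun p : Lp ℂ 2 (surfaceMeasure n) × Lp ℂ 2 (surfaceMeasure n) =>
    (p.1, p.2 + ((γ' - γ : ℝ) : ℂ) • cosMul n p.1)) (by fun_prop) h ?_
  rintro ⟨f, g⟩ hfg
  obtain ⟨φ, hφ, h1, h2⟩ := exists_of_mem_smoothDipoleGraph hfg
  convert mem_smoothDipoleGraph_of_laplaceBeltrami hφ γ' h1 h2 using 2
  push_cast
  rw [sub_smul]
  abel

/-- The resolvent `(-Δ + c)⁻¹` on the sphere. -/
abbrev sphResolvent (n : ℕ) (c : ℝ) : Lp ℂ 2 (surfaceMeasure n) →L[ℂ] Lp ℂ 2 (surfaceMeasure n) :=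
  diagResolvent (harmL2 n) (sphEigenvalue n) c

/-- The equation is `(-Δ + c) f = g + c f - γ cos θ f` with the resolvent applied. It replaces the
closure, about which nothing is known directly, by a bounded operator, and plays the role of
essential self-adjointness. -/
theorem mem_dipoleGraph_iff (hn : 2 ≤ n) {γ c : ℝ} (hc : 1 ≤ c) {f g : Lp ℂ 2 (surfaceMeasure n)} :
    (f, g) ∈ dipoleGraph n γ ↔
      f = sphResolvent n c (g + (c : ℂ) • f - (γ : ℂ) • cosMul n f) := by
  have : Nontrivial (EuclideanSpace ℝ (Fin n)) := by
    have : Nonempty (Fin n) := ⟨⟨0, by omega⟩⟩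
    infer_instance
  have hν := sq_le_sphEigenvalue (n := n) hn
  have hO := pairwise_isOrtho_harmL2 (n := n) hn
  have hpos : ∀ k, (sphEigenvalue n k : ℂ) + c ≠ 0 := by
    intro k
    have h0 := (sq_nonneg _).trans (hν k)
    have : sphEigenvalue n k + c ≠ 0 := by positivity
    exact_mod_cast this
  constructor
  · intro h
    have hcl : IsClosed {p : Lp ℂ 2 (surfaceMeasure n) × Lp ℂ 2 (surfaceMeasure n) |
        p.1 = sphResolvent n c (p.2 + (c : ℂ) • p.1 - (γ : ℂ) • cosMul n p.1)} :=
      isClosed_eq (by fun_prop) (by fun_prop)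
    refine closure_minimal ?_ hcl h
    rintro ⟨f, g⟩ hfg
    obtain ⟨φ, hφ, h1, h2⟩ := exists_of_mem_smoothDipoleGraph hfg
    change f = sphResolvent n c (g + (c : ℂ) • f - (γ : ℂ) • cosMul n f)
    rw [add_sub_right_comm]
    set h := g - (γ : ℂ) • cosMul n f
    rw [← sub_eq_zero]
    -- The equation is closed, so smooth `φ` suffice; there the difference of the two sides is
    -- orthogonal to every spherical harmonic, hence zero by density.
    have hmem : f - sphResolvent n c (h + (c : ℂ) • f) ∈ (⨆ k, harmL2 n k)ᗮ := by
      rw [← Submodule.iInf_orthogonal, Submodule.mem_iInf]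
      intro k
      rw [Submodule.mem_orthogonal]
      rintro _ ⟨u, hu, rfl⟩
      have e1 : inner ℂ (toL2 n u) (sphResolvent n c (h + (c : ℂ) • f)) =
          inner ℂ (sphResolvent n c (toL2 n u)) (h + (c : ℂ) • f) :=
        (isSymmetric_diagResolvent hν hc _ _).symm
      have e2 := inner_eigenfunction_eq (isSmoothOnSphere_of_mem_harmSpace hu) hu.2 hφ h1 h2
      change inner ℂ (toL2 n u) _ = 0
      have e3 : sphResolvent n c (toL2 n u) = (((sphEigenvalue n k + c)⁻¹ : ℝ) : ℂ) • toL2 n u :=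
        diagResolvent_apply_of_mem hO hν hc (Submodule.mem_map_of_mem hu)
      rw [inner_sub_right, e1, e3, inner_smul_left, Complex.conj_ofReal, inner_add_right,
        inner_smul_right, e2, ← add_mul]
      push_cast
      rw [inv_mul_cancel_left₀ (hpos k), sub_self]
    rw [Submodule.topologicalClosure_eq_top_iff.mp (topologicalClosure_iSup_harmL2 hn)] at hmem
    exact hmem
  · intro h
    -- On a spherical harmonic the resolvent is a scalar, so the pair lies in the smooth graph;
    -- density and continuity extend this to every `h`.
    have key : ∀ h, (sphResolvent n c h, h + (γ : ℂ) • cosMul n (sphResolvent n c h) -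
        (c : ℂ) • sphResolvent n c h) ∈ (smoothDipoleSubmodule n γ).topologicalClosure := by
      set Φ : Lp ℂ 2 (surfaceMeasure n) →L[ℂ]
          Lp ℂ 2 (surfaceMeasure n) × Lp ℂ 2 (surfaceMeasure n) :=
        (sphResolvent n c).prod (ContinuousLinearMap.id ℂ _ +
          (γ : ℂ) • (cosMul n ∘L sphResolvent n c) - (c : ℂ) • sphResolvent n c)
      have hle : (⨆ k, harmL2 n k).topologicalClosure ≤
          ((smoothDipoleSubmodule n γ).topologicalClosure).comap Φ.toLinearMap := by
        refine Submodule.topologicalClosure_minimal _ (iSup_le fun k => ?_)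
          ((Submodule.isClosed_topologicalClosure _).preimage Φ.continuous)
        rintro _ ⟨u, hu, rfl⟩
        refine Submodule.le_topologicalClosure _ ?_
        have e1 : sphResolvent n c (toL2 n u) = (((sphEigenvalue n k + c)⁻¹ : ℝ) : ℂ) • toL2 n u :=
          diagResolvent_apply_of_mem hO hν hc (Submodule.mem_map_of_mem hu)
        have e2 := mem_smoothDipoleGraph_of_laplaceBeltrami (isSmoothOnSphere_of_mem_harmSpace hu)
          γ (coeFn_toL2 u) (eigenfunction_smul_ae_eq hu.2)
        have e3 := (smoothDipoleSubmodule n γ).smul_mem (((sphEigenvalue n k + c)⁻¹ : ℝ) : ℂ) e2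
        convert e3 using 1
        change (sphResolvent n c (toL2 n u), toL2 n u + (γ : ℂ) • cosMul n
          (sphResolvent n c (toL2 n u)) - (c : ℂ) • sphResolvent n c (toL2 n u)) = _
        rw [e1, Prod.smul_mk]
        congr 1
        rw [map_smul, smul_add, smul_comm (γ : ℂ), add_sub_right_comm]
        congr 1
        rw [smul_smul, smul_smul]
        nth_rewrite 1 [← one_smul ℂ (toL2 n u)]
        rw [← sub_smul]
        congr 1
        push_cast
        have := hpos k
        field_simp
        ring
      intro h
      have : h ∈ (⨆ k, harmL2 n k).topologicalClosure := by
        rw [topologicalClosure_iSup_harmL2 hn]; trivial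
      exact hle this
    have h2 := key (g + (c : ℂ) • f - (γ : ℂ) • cosMul n f)
    rw [← h] at h2
    have h3 : g + (c : ℂ) • f - (γ : ℂ) • cosMul n f + (γ : ℂ) • cosMul n f - (c : ℂ) • f = g := by
      abel
    rw [h3] at h2
    exact h2

theorem re_inner_nonneg_of_mem_dipoleGraph_zero (hn : 2 ≤ n) {f g : Lp ℂ 2 (surfaceMeasure n)}
    (h : (f, g) ∈ dipoleGraph n 0) : 0 ≤ (inner ℂ f g).re := by
  have h1 := (mem_dipoleGraph_iff hn le_rfl).mp h
  have h2 := le_re_inner_diagResolvent (pairwise_isOrtho_harmL2 hn) (sq_le_sphEigenvalue hn)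
    le_rfl (g + ((1 : ℝ) : ℂ) • f - ((0 : ℝ) : ℂ) • cosMul n f)
  rw [← h1, Complex.ofReal_zero, zero_smul, sub_zero, inner_add_right, Complex.ofReal_one, one_smul,
    Complex.add_re, re_inner_self] at h2
  linarith

theorem toL2_one_ne_zero (hn : 2 ≤ n) : toL2 n (ridge 0 0) ≠ 0 := by
  intro h
  have h1 := toL2_injective (h.trans (map_zero (toL2 n)).symm)
  have h2 := congrArg (fun u : C(Sph n, ℂ) => u ⟨northPole n, by
    simp [norm_northPole (show 0 < n by omega)]⟩) h1
  simp [ridge_apply] at h2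

theorem ridge_zero_mem_harmSpace : ridge (0 : EuclideanSpace ℝ (Fin n)) 0 ∈ harmSpace n 0 := by
  refine ⟨ridge_mem_polySpace 0 le_rfl, ?_⟩
  ext x
  simp [laplaceBeltrami_ridge]

/-- The lowest eigenvalue is attained, and it is the minimum of the quadratic form. -/
theorem lowestEigenvalue_spec (hn : 2 ≤ n) (γ : ℝ) :
    IsDipoleEigenvalue n γ (lowestEigenvalue n γ) ∧
      ∀ f g, (f, g) ∈ dipoleGraph n γ → lowestEigenvalue n γ * ‖f‖ ^ 2 ≤ (inner ℂ f g).re := by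
  -- The shift `|γ| + 1` exceeds the norm of the perturbation `γ cos θ` and meets the bound `1 ≤ c`
  -- of the resolvent lemmas.
  have hc : 1 ≤ |γ| + 1 := by linarith [abs_nonneg γ]
  have hν := sq_le_sphEigenvalue (n := n) hn
  have hO := pairwise_isOrtho_harmL2 (n := n) hn
  have hne := toL2_one_ne_zero hn
  have : Nontrivial (Lp ℂ 2 (surfaceMeasure n)) := ⟨_, _, hne⟩
  have hR0 : sphResolvent n (|γ| + 1) ≠ 0 := by
    intro h
    have h1 := diagResolvent_apply_of_mem hO hν hc
      (Submodule.mem_map_of_mem (ridge_zero_mem_harmSpace (n := n)))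
    rw [show diagResolvent (harmL2 n) (sphEigenvalue n) (|γ| + 1) = 0 from h, zero_apply, eq_comm,
      smul_eq_zero] at h1
    refine h1.elim (fun h2 => ?_) hne
    have : (0 : ℝ) < |γ| + 1 := by positivity
    simp [sphEigenvalue] at h2
    norm_cast at h2
    linarith
  obtain ⟨l, ⟨f, hf0, hf⟩, hl⟩ := exists_ground_state (isSymmetric_diagResolvent hν hc)
    (isCompactOperator_diagResolvent hν hc) (le_re_inner_diagResolvent hO hν hc) hR0
    isSymmetric_cosMul norm_cosMul_le (lt_add_one |γ|)
  have hmem : IsDipoleEigenvalue n γ l := ⟨f, hf0, (mem_dipoleGraph_iff hn hc).mpr hf⟩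
  have hform : ∀ f g, (f, g) ∈ dipoleGraph n γ → l * ‖f‖ ^ 2 ≤ (inner ℂ f g).re :=
    fun f g hfg => hl f g ((mem_dipoleGraph_iff hn hc).mp hfg)
  have hleast : IsLeast {μ : ℝ | IsDipoleEigenvalue n γ μ} l := by
    refine ⟨hmem, ?_⟩
    rintro μ ⟨f, hf0, hf⟩
    have h1 := hform _ _ hf
    rw [inner_smul_right, Complex.re_ofReal_mul, re_inner_self] at h1
    exact le_of_mul_le_mul_right h1 (by have := norm_pos_iff.mpr hf0; positivity)
  rw [lowestEigenvalue, hleast.csInf_eq]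
  exact ⟨hmem, hform⟩

end SphereOperator

/-! ### Zonal harmonics -/

section Zonal

open Polynomial

variable {n : ℕ}

theorem jacobiCoeff_succ_sq (hn : 3 ≤ n) (ℓ : ℕ) :
    jacobiCoeff n (ℓ + 1) ^ 2 =
      ((ℓ + 1 : ℝ) * (ℓ + n - 2)) / ((2 * ℓ + n - 2) * (2 * ℓ + n)) := by
  have h3 : (3 : ℝ) ≤ n := by exact_mod_cast hn
  have hl : (0 : ℝ) ≤ ℓ := ℓ.cast_nonneg
  have e : (((ℓ + 1 : ℕ) : ℝ) * ((ℓ + 1 : ℕ) + n - 3)) /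
      ((2 * ((ℓ + 1 : ℕ) : ℝ) + n - 4) * (2 * ((ℓ + 1 : ℕ) : ℝ) + n - 2)) =
      ((ℓ + 1 : ℝ) * (ℓ + n - 2)) / ((2 * ℓ + n - 2) * (2 * ℓ + n)) := by
    push_cast
    congr 1 <;> ring
  rw [jacobiCoeff, e, Real.sq_sqrt]
  exact div_nonneg (mul_nonneg (by linarith) (by linarith))
    (mul_nonneg (by linarith) (by linarith))

theorem jacobiCoeff_succ_pos (hn : 3 ≤ n) (ℓ : ℕ) : 0 < jacobiCoeff n (ℓ + 1) := by
  have h3 : (3 : ℝ) ≤ n := by exact_mod_cast hn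
  have hl : (0 : ℝ) ≤ ℓ := ℓ.cast_nonneg
  have h0 : 0 ≤ jacobiCoeff n (ℓ + 1) := Real.sqrt_nonneg _
  refine lt_of_le_of_ne h0 fun h => ?_
  have h2 := jacobiCoeff_succ_sq hn ℓ
  rw [← h] at h2
  refine absurd h2 (ne_of_lt ?_)
  rw [zero_pow two_ne_zero]
  exact div_pos (mul_pos (by linarith) (by linarith)) (mul_pos (by linarith) (by linarith))

/-- The monic Gegenbauer polynomials. -/
def zonalPoly (n : ℕ) : ℕ → ℂ[X]
  | 0 => 1
  | 1 => X
  | ℓ + 2 => X * zonalPoly n (ℓ + 1) - C ((jacobiCoeff n (ℓ + 1) : ℂ) ^ 2) * zonalPoly n ℓ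

theorem zonalPoly_add_two (ℓ : ℕ) : zonalPoly n (ℓ + 2) =
    X * zonalPoly n (ℓ + 1) - C ((jacobiCoeff n (ℓ + 1) : ℂ) ^ 2) * zonalPoly n ℓ := rfl

/-- The denominators are cleared so that the recurrence arguments become polynomial identities. -/
theorem jacobiCoeff_sq_C (hn : 3 ≤ n) (ℓ : ℕ) :
    (2 * (ℓ : ℂ[X]) + n - 2) * (2 * ℓ + n) * C ((jacobiCoeff n (ℓ + 1) : ℂ) ^ 2) =
      (ℓ + 1) * (ℓ + n - 2) := by
  have h3 : (3 : ℝ) ≤ n := by exact_mod_cast hn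
  have hl : (0 : ℝ) ≤ ℓ := ℓ.cast_nonneg
  have h1 := jacobiCoeff_succ_sq hn ℓ
  rw [eq_div_iff (mul_ne_zero (by linarith) (by linarith))] at h1
  have h2 : ((2 * (ℓ : ℂ) + n - 2) * (2 * ℓ + n)) * (jacobiCoeff n (ℓ + 1) : ℂ) ^ 2 =
      (ℓ + 1) * (ℓ + n - 2) := by
    rw [mul_comm]
    exact_mod_cast h1
  have h4 := congrArg C h2
  simp only [map_mul, map_add, map_sub, map_natCast, map_one, map_ofNat] at h4
  exact h4

theorem two_mul_add_sub_two_ne_zero (hn : 3 ≤ n) (ℓ : ℕ) : (2 * (ℓ : ℂ[X]) + n - 2) ≠ 0 := by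
  have : (2 * (ℓ : ℂ[X]) + n - 2) = ((2 * ℓ + (n - 2) : ℕ) : ℂ[X]) := by
    push_cast [Nat.cast_sub (show 2 ≤ n by omega)]
    ring
  rw [this, Nat.cast_ne_zero]
  omega

/-- Two contiguous relations for the monic Gegenbauer polynomials, proved together because the
induction mixes them: the second at `ℓ + 1` uses the first at `ℓ`, and the first at `ℓ + 1` uses
both at `ℓ` and the new second one. -/
theorem derivative_zonalPoly (hn : 3 ≤ n) (ℓ : ℕ) :
    ((ℓ : ℂ[X]) + 1) * derivative (zonalPoly n ℓ) =
      (2 * (ℓ : ℂ[X]) + (n : ℂ[X]) - 2) *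
        (X * derivative (zonalPoly n (ℓ + 1)) - ((ℓ : ℂ[X]) + 1) * zonalPoly n (ℓ + 1)) ∧
    (2 * (ℓ : ℂ[X]) + (n : ℂ[X]) - 2) * derivative (zonalPoly n (ℓ + 1)) =
      ((ℓ : ℂ[X]) + 1) *
        (X * derivative (zonalPoly n ℓ) + ((ℓ : ℂ[X]) + (n : ℂ[X]) - 2) * zonalPoly n ℓ) := by
  induction ℓ with
  | zero => simp [zonalPoly]
  | succ ℓ ih =>
    obtain ⟨h2, h3⟩ := ih
    have hA := jacobiCoeff_sq_C hn ℓ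
    have hD := two_mul_add_sub_two_ne_zero hn ℓ
    rw [zonalPoly_add_two]
    set A := C ((jacobiCoeff n (ℓ + 1) : ℂ) ^ 2) with hAdef
    set q := zonalPoly n (ℓ + 1)
    set s := zonalPoly n ℓ
    have hd : derivative (X * q - A * s) = q + X * derivative q - A * derivative s := by
      simp [hAdef, derivative_mul]
    rw [hd]
    have h3' : (2 * ((ℓ + 1 : ℕ) : ℂ[X]) + (n : ℂ[X]) - 2) *
        (q + X * derivative q - A * derivative s) = (((ℓ + 1 : ℕ) : ℂ[X]) + 1) *
          (X * derivative q + (((ℓ + 1 : ℕ) : ℂ[X]) + (n : ℂ[X]) - 2) * q) := by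
      refine mul_left_cancel₀ hD ?_
      push_cast
      linear_combination (-derivative s) * hA - ((ℓ : ℂ[X]) + n - 2) * h2
    refine ⟨?_, h3'⟩
    refine mul_left_cancel₀ hD ?_
    push_cast at h3' ⊢
    linear_combination ((ℓ : ℂ[X]) + 2) * h3 - (2 * (ℓ : ℂ[X]) + n - 2) * X * h3' +
      ((ℓ : ℂ[X]) + 2) * X * h2 - ((ℓ : ℂ[X]) + 2) * s * hA

/-- Differentiating both contiguous relations and eliminating `zonalPoly n ℓ` leaves the Gegenbauer
equation of index `ℓ + 1`. -/
theorem zonalPoly_ode (hn : 3 ≤ n) (ℓ : ℕ) :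
    (1 - X ^ 2) * derivative (derivative (zonalPoly n ℓ)) -
      ((n : ℂ[X]) - 1) * X * derivative (zonalPoly n ℓ) =
    -((ℓ : ℂ[X]) * ((ℓ : ℂ[X]) + (n : ℂ[X]) - 2)) * zonalPoly n ℓ := by
  rcases ℓ with _ | ℓ
  · simp [zonalPoly]
  · obtain ⟨h2, h3⟩ := derivative_zonalPoly hn ℓ
    have hD := two_mul_add_sub_two_ne_zero hn ℓ
    have h2' := congrArg derivative h2
    have h3' := congrArg derivative h3
    simp only [derivative_mul, derivative_add, derivative_sub, derivative_natCast, derivative_one,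
      derivative_ofNat, derivative_X, zero_mul, mul_zero, add_zero, zero_add, sub_zero,
      one_mul] at h2' h3'
    refine mul_left_cancel₀ hD ?_
    push_cast
    linear_combination h3' + X * h2' + ((ℓ : ℂ[X]) + n - 1) * h2

theorem aeval_ridge_monomial (c : EuclideanSpace ℝ (Fin n)) (j : ℕ) (a : ℂ) :
    aeval (ridge c 1) (monomial j a) = a • ridge c j := by
  rw [aeval_monomial, ridge_one_pow, Algebra.algebraMap_eq_smul_one, smul_mul_assoc, one_mul]

/-- On functions of `t = ⟪c, x⟫` the spherical Laplacian is `(1-t²) ∂_t² - (n-1) t ∂_t`; by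
linearity it is enough to treat monomials. -/
theorem laplaceBeltrami_aeval_ridge {c : EuclideanSpace ℝ (Fin n)} (hc : ‖c‖ = 1) (p : ℂ[X]) :
    IsSmoothOnSphere (aeval (ridge c 1) p) ∧
    laplaceBeltrami (aeval (ridge c 1) p) = ⇑(aeval (ridge c 1)
      ((1 - X ^ 2) * derivative (derivative p) - ((n : ℂ[X]) - 1) * X * derivative p)) := by
  induction p using Polynomial.induction_on' with
  | add p q hp hq =>
    rw [map_add, ContinuousMap.coe_add]
    refine ⟨hp.1.add hq.1, ?_⟩
    rw [laplaceBeltrami_add hp.1 hq.1, hp.2, hq.2, ← ContinuousMap.coe_add, ← map_add]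
    congr 2
    simp only [derivative_add]
    ring
  | monomial j a =>
    rw [aeval_ridge_monomial, ContinuousMap.coe_smul]
    refine ⟨(isSmoothOnSphere_ridge c j).const_smul a, ?_⟩
    rw [laplaceBeltrami_const_smul (isSmoothOnSphere_ridge c j)]
    ext x
    have hx : ∀ q : ℂ[X], aeval (ridge c 1) q x = q.eval (ridge c 1 x) := fun q => by
      rw [← ContinuousMap.evalAlgHom_apply ℂ ℂ x, ← aeval_algHom_apply, ← coe_aeval_eq_eval]
      rfl
    rw [hx, Pi.smul_apply, laplaceBeltrami_ridge, ← ridge_one_pow, ← ridge_one_pow c j, hc]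
    simp only [derivative_monomial, eval_sub, eval_mul, eval_one, eval_pow, eval_X, eval_natCast,
      eval_monomial, ContinuousMap.pow_apply, sphEigenvalue, smul_eq_mul]
    rcases j with _ | _ | j
    · simp
    · simp
      ring
    · change a * (((j + 1 + 1 : ℕ) * ((j + 1 + 1 : ℕ) - 1) * ((1 : ℝ) : ℂ) ^ 2) * _ ^ j - _) =
        (1 - _) * (a * (j + 1 + 1 : ℕ) * (j + 1 : ℕ) * _ ^ j) -
          _ * (a * (j + 1 + 1 : ℕ) * _ ^ (j + 1))
      push_cast
      ring

/-- The zonal harmonics, not normalized. -/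
def zonal (n ℓ : ℕ) : C(Sph n, ℂ) := aeval (ridge (northPole n) 1) (zonalPoly n ℓ)

theorem isSmoothOnSphere_zonal (hn : 3 ≤ n) (ℓ : ℕ) : IsSmoothOnSphere (zonal n ℓ) :=
  (laplaceBeltrami_aeval_ridge (norm_northPole (by omega)) _).1

theorem laplaceBeltrami_zonal (hn : 3 ≤ n) (ℓ : ℕ) :
    laplaceBeltrami (zonal n ℓ) = (-(sphEigenvalue n ℓ : ℂ)) • ⇑(zonal n ℓ) := by
  rw [zonal, (laplaceBeltrami_aeval_ridge (norm_northPole (by omega)) _).2, zonalPoly_ode hn,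
    ← ContinuousMap.coe_smul]
  congr 1
  have h : -((ℓ : ℂ[X]) * ((ℓ : ℂ[X]) + (n : ℂ[X]) - 2)) = C (-(sphEigenvalue n ℓ : ℂ)) := by
    rw [sphEigenvalue]
    push_cast
    simp only [map_neg, map_mul, map_add, map_sub, map_natCast, map_ofNat]
  rw [h, ← smul_eq_C_mul, map_smul]

theorem zonal_zero_eq : zonal n 0 = ridge 0 0 := by
  ext x
  simp [zonal, zonalPoly, ridge_apply]

theorem cosMul_zonal_zero : cosMul n (toL2 n (zonal n 0)) = toL2 n (zonal n 1) := by
  rw [cosMul_toL2]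
  simp [zonal, zonalPoly]

theorem cosMul_zonal_succ (ℓ : ℕ) : cosMul n (toL2 n (zonal n (ℓ + 1))) =
    toL2 n (zonal n (ℓ + 2)) + ((jacobiCoeff n (ℓ + 1) : ℂ) ^ 2) • toL2 n (zonal n ℓ) := by
  rw [cosMul_toL2, ← map_smul, ← map_add]
  congr 1
  rw [zonal, zonal, zonal, zonalPoly_add_two, map_sub, map_mul, aeval_X, ← smul_eq_C_mul, map_smul,
    sub_add_cancel]

theorem inner_zonal_eq_zero (hn : 3 ≤ n) {i j : ℕ} (hij : i ≠ j) :
    inner ℂ (toL2 n (zonal n i)) (toL2 n (zonal n j)) = 0 := by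
  have : Nontrivial (EuclideanSpace ℝ (Fin n)) := by
    have : Nonempty (Fin n) := ⟨⟨0, by omega⟩⟩
    infer_instance
  have h1 := inner_eigenfunction_eq (isSmoothOnSphere_zonal hn i) (laplaceBeltrami_zonal hn i)
    (isSmoothOnSphere_zonal hn j) (coeFn_toL2 _)
    (eigenfunction_smul_ae_eq (laplaceBeltrami_zonal hn j))
  rw [inner_smul_right, ← sub_eq_zero, ← sub_mul] at h1
  refine (mul_eq_zero.mp h1).resolve_left ?_
  refine sub_ne_zero.mpr ?_
  exact_mod_cast (sphEigenvalue_strictMono (show 2 ≤ n by omega)).injective.ne hij.symm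

/-- Evaluate `⟨p_{ℓ+1}, cos θ · p_ℓ⟩` twice: the recurrence for `p_ℓ` gives `‖p_{ℓ+1}‖²`, and moving
`cos θ` to the left gives `a_{ℓ+1}² ‖p_ℓ‖²`. Normalization therefore makes the monic recurrence
symmetric. -/
theorem norm_zonal_succ (hn : 3 ≤ n) (ℓ : ℕ) :
    ‖toL2 n (zonal n (ℓ + 1))‖ = jacobiCoeff n (ℓ + 1) * ‖toL2 n (zonal n ℓ)‖ := by
  have h1 : inner ℂ (toL2 n (zonal n (ℓ + 1))) (cosMul n (toL2 n (zonal n ℓ))) =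
      inner ℂ (toL2 n (zonal n (ℓ + 1))) (toL2 n (zonal n (ℓ + 1))) := by
    rcases ℓ with _ | ℓ
    · rw [cosMul_zonal_zero]
    · rw [cosMul_zonal_succ, inner_add_right, inner_smul_right,
        inner_zonal_eq_zero hn (by omega : ℓ + 1 + 1 ≠ ℓ), mul_zero, add_zero]
  have h2 : inner ℂ (cosMul n (toL2 n (zonal n (ℓ + 1)))) (toL2 n (zonal n ℓ)) =
      (jacobiCoeff n (ℓ + 1) : ℂ) ^ 2 * inner ℂ (toL2 n (zonal n ℓ)) (toL2 n (zonal n ℓ)) := by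
    rw [cosMul_zonal_succ, inner_add_left, inner_smul_left,
      inner_zonal_eq_zero hn (by omega : ℓ + 2 ≠ ℓ), zero_add, map_pow, Complex.conj_ofReal]
  have h3 : inner ℂ (cosMul n (toL2 n (zonal n (ℓ + 1)))) (toL2 n (zonal n ℓ)) =
      inner ℂ (toL2 n (zonal n (ℓ + 1))) (cosMul n (toL2 n (zonal n ℓ))) := isSymmetric_cosMul _ _
  rw [h3, h1] at h2
  have h4 := congrArg Complex.re h2
  rw [← Complex.ofReal_pow, Complex.re_ofReal_mul, re_inner_self, re_inner_self, ← mul_pow] at h4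
  exact (pow_left_inj₀ (norm_nonneg _) (mul_nonneg (Real.sqrt_nonneg _) (norm_nonneg _))
    two_ne_zero).mp h4

theorem norm_zonal_pos (hn : 3 ≤ n) (ℓ : ℕ) : 0 < ‖toL2 n (zonal n ℓ)‖ := by
  induction ℓ with
  | zero =>
    rw [zonal_zero_eq]
    exact norm_pos_iff.mpr (toL2_one_ne_zero (by omega))
  | succ ℓ ih =>
    rw [norm_zonal_succ hn]
    exact mul_pos (jacobiCoeff_succ_pos hn ℓ) ih

/-- The normalized zonal harmonics. -/
def zonalUnit (n ℓ : ℕ) : Lp ℂ 2 (surfaceMeasure n) :=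
  ((‖toL2 n (zonal n ℓ)‖⁻¹ : ℝ) : ℂ) • toL2 n (zonal n ℓ)

theorem toL2_zonal_eq (hn : 3 ≤ n) (ℓ : ℕ) :
    toL2 n (zonal n ℓ) = (‖toL2 n (zonal n ℓ)‖ : ℂ) • zonalUnit n ℓ := by
  have h : (‖toL2 n (zonal n ℓ)‖ : ℂ) ≠ 0 := by exact_mod_cast (norm_zonal_pos hn ℓ).ne'
  rw [zonalUnit, smul_smul]
  push_cast
  rw [mul_inv_cancel₀ h, one_smul]

theorem orthonormal_zonalUnit (hn : 3 ≤ n) : Orthonormal ℂ (zonalUnit n) := by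
  refine ⟨fun ℓ => ?_, fun i j hij => ?_⟩
  · have h := norm_zonal_pos hn ℓ
    rw [zonalUnit, norm_smul, Complex.norm_real, Real.norm_of_nonneg (by positivity),
      inv_mul_cancel₀ h.ne']
  · change inner ℂ (zonalUnit n i) (zonalUnit n j) = 0
    rw [zonalUnit, zonalUnit, inner_smul_left, inner_smul_right, inner_zonal_eq_zero hn hij]
    simp

theorem cosMul_zonalUnit_zero (hn : 3 ≤ n) :
    cosMul n (zonalUnit n 0) = (jacobiCoeff n 1 : ℂ) • zonalUnit n 1 := by
  have h : (‖toL2 n (zonal n 0)‖ : ℂ) ≠ 0 := by exact_mod_cast (norm_zonal_pos hn 0).ne'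
  nth_rewrite 1 [zonalUnit]
  rw [map_smul, cosMul_zonal_zero, toL2_zonal_eq hn 1, norm_zonal_succ hn 0, smul_smul]
  congr 1
  push_cast
  field_simp

theorem cosMul_zonalUnit_succ (hn : 3 ≤ n) (ℓ : ℕ) :
    cosMul n (zonalUnit n (ℓ + 1)) = (jacobiCoeff n (ℓ + 2) : ℂ) • zonalUnit n (ℓ + 2) +
      (jacobiCoeff n (ℓ + 1) : ℂ) • zonalUnit n ℓ := by
  have h : (‖toL2 n (zonal n ℓ)‖ : ℂ) ≠ 0 := by exact_mod_cast (norm_zonal_pos hn ℓ).ne'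
  have ha : (jacobiCoeff n (ℓ + 1) : ℂ) ≠ 0 := by exact_mod_cast (jacobiCoeff_succ_pos hn ℓ).ne'
  nth_rewrite 1 [zonalUnit]
  rw [map_smul, cosMul_zonal_succ, toL2_zonal_eq hn (ℓ + 2), toL2_zonal_eq hn ℓ,
    norm_zonal_succ hn (ℓ + 1), norm_zonal_succ hn ℓ, smul_add, smul_smul, smul_smul, smul_smul]
  congr 2
  · push_cast
    field_simp
  · push_cast
    field_simp

theorem zonalUnit_mem_dipoleGraph (hn : 3 ≤ n) (γ : ℝ) (ℓ : ℕ) :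
    (zonalUnit n ℓ, (sphEigenvalue n ℓ : ℂ) • zonalUnit n ℓ + (γ : ℂ) • cosMul n (zonalUnit n ℓ)) ∈
      (smoothDipoleSubmodule n γ).topologicalClosure := by
  refine Submodule.le_topologicalClosure _ ?_
  have h1 := mem_smoothDipoleGraph_of_laplaceBeltrami (isSmoothOnSphere_zonal hn ℓ) γ
    (coeFn_toL2 _) (eigenfunction_smul_ae_eq (laplaceBeltrami_zonal hn ℓ))
  have h2 := (smoothDipoleSubmodule n γ).smul_mem ((‖toL2 n (zonal n ℓ)‖⁻¹ : ℝ) : ℂ) h1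
  convert h2 using 1
  rw [Prod.smul_mk, smul_add, zonalUnit, map_smul, smul_comm (γ : ℂ),
    smul_comm (sphEigenvalue n ℓ : ℂ)]

/-- The isometry of `ℓ²` onto the closed span of the zonal harmonics. -/
def zonalEmbedding (hn : 3 ≤ n) : EllTwo →ₗᵢ[ℂ] Lp ℂ 2 (surfaceMeasure n) :=
  (orthonormal_zonalUnit hn).orthogonalFamily.linearIsometry

theorem zonalEmbedding_single (hn : 3 ≤ n) (ℓ : ℕ) (z : ℂ) :
    zonalEmbedding hn (lp.single 2 ℓ z) = z • zonalUnit n ℓ := by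
  rw [zonalEmbedding, OrthogonalFamily.linearIsometry_apply_single]
  rfl

theorem coe_single (ℓ i : ℕ) (z : ℂ) :
    (lp.single 2 ℓ z : EllTwo) i = if i = ℓ then z else 0 := by
  rw [lp.single_apply, Pi.single_apply]

theorem jacobiOp_single_zero (z : ℂ) : jacobiOp n (lp.single 2 0 z) =
    (jacobiCoeff n 1 : ℂ) • (lp.single 2 1 z : EllTwo) := by
  ext i
  rw [lp.coeFn_smul, Pi.smul_apply, coe_single, smul_eq_mul]
  rcases i with _ | i
  · rw [jacobiOp_apply_zero, coe_single]
    simp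
  · rw [jacobiOp_apply_succ, coe_single, coe_single]
    by_cases hi : i = 0 <;> simp [hi]

theorem jacobiOp_single_succ (ℓ : ℕ) (z : ℂ) : jacobiOp n (lp.single 2 (ℓ + 1) z) =
    (jacobiCoeff n (ℓ + 2) : ℂ) • (lp.single 2 (ℓ + 2) z : EllTwo) +
      (jacobiCoeff n (ℓ + 1) : ℂ) • (lp.single 2 ℓ z : EllTwo) := by
  ext i
  rw [lp.coeFn_add, Pi.add_apply, lp.coeFn_smul, lp.coeFn_smul, Pi.smul_apply, Pi.smul_apply,
    coe_single, coe_single, smul_eq_mul, smul_eq_mul]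
  rcases i with _ | i
  · rw [jacobiOp_apply_zero, coe_single]
    rcases ℓ with _ | ℓ <;> simp
  · rw [jacobiOp_apply_succ, coe_single, coe_single]
    by_cases h1 : i = ℓ + 1
    · subst h1
      simp [show ¬ (ℓ + 1 + 1 = ℓ) by omega]
    · by_cases h2 : i + 1 = ℓ
      · subst h2
        simp [h1]
      · simp [h1, h2, show ¬ (i + 2 = ℓ + 1) by omega]

/-- `J` is multiplication by `cos θ` restricted to the zonal subspace. Both sides are continuous, so
basis vectors suffice. -/
theorem cosMul_zonalEmbedding (hn : 3 ≤ n) (d : EllTwo) :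
    cosMul n (zonalEmbedding hn d) = zonalEmbedding hn (jacobiOp n d) := by
  have h : cosMul n ∘L (zonalEmbedding hn).toContinuousLinearMap =
      (zonalEmbedding hn).toContinuousLinearMap ∘L jacobiOp n := by
    refine lp.ext_continuousLinearMap (by norm_num) fun ℓ => ?_
    refine ContinuousLinearMap.ext_ring ?_
    change cosMul n (zonalEmbedding hn (lp.single 2 ℓ 1)) =
      zonalEmbedding hn (jacobiOp n (lp.single 2 ℓ 1))
    rcases ℓ with _ | ℓ
    · rw [jacobiOp_single_zero, map_smul, zonalEmbedding_single, zonalEmbedding_single, one_smul,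
        one_smul, cosMul_zonalUnit_zero hn]
    · rw [jacobiOp_single_succ, map_add, map_smul, map_smul, zonalEmbedding_single,
        zonalEmbedding_single, zonalEmbedding_single, one_smul, one_smul, one_smul,
        cosMul_zonalUnit_succ hn]
  exact congrArg (fun T => T d) h

end Zonal

/-! ### The lowest eigenvalue and the critical dipole moment -/

section Critical

variable {n : ℕ}

/-- The variational principle on zonal trial functions; finite sums lie in the operator domain
without any convergence question. -/
theorem lowestEigenvalue_mul_le (hn : 3 ≤ n) (γ : ℝ) (s : Finset ℕ) (d : ℕ → ℂ) :
    lowestEigenvalue n γ * ∑ ℓ ∈ s, ‖d ℓ‖ ^ 2 ≤ ∑ ℓ ∈ s, sphEigenvalue n ℓ * ‖d ℓ‖ ^ 2 +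
      γ * (inner ℂ (∑ ℓ ∈ s, lp.single 2 ℓ (d ℓ) : EllTwo)
        (jacobiOp n (∑ ℓ ∈ s, lp.single 2 ℓ (d ℓ) : EllTwo))).re := by
  set D : EllTwo := ∑ ℓ ∈ s, lp.single 2 ℓ (d ℓ) with hD
  have hU : zonalEmbedding hn D = ∑ ℓ ∈ s, d ℓ • zonalUnit n ℓ := by
    rw [hD, map_sum]
    exact Finset.sum_congr rfl fun ℓ _ => zonalEmbedding_single hn ℓ (d ℓ)
  have ho := orthonormal_zonalUnit hn
  have hmem : (zonalEmbedding hn D, ∑ ℓ ∈ s, ((sphEigenvalue n ℓ : ℂ) * d ℓ) • zonalUnit n ℓ +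
      (γ : ℂ) • cosMul n (zonalEmbedding hn D)) ∈
      (smoothDipoleSubmodule n γ).topologicalClosure := by
    have h := Submodule.sum_mem (smoothDipoleSubmodule n γ).topologicalClosure
      (fun ℓ (_ : ℓ ∈ s) => Submodule.smul_mem _ (d ℓ) (zonalUnit_mem_dipoleGraph hn γ ℓ))
    convert h using 1
    refine Prod.ext ?_ ?_
    · rw [hU, Prod.fst_sum]
      rfl
    · rw [Prod.snd_sum, hU, map_sum, Finset.smul_sum, ← Finset.sum_add_distrib]
      refine Finset.sum_congr rfl fun ℓ _ => ?_
      rw [map_smul]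
      change _ = d ℓ • (_ + _)
      simp only [smul_add, smul_smul, mul_comm]
  have h1 := (lowestEigenvalue_spec (show 2 ≤ n by omega) γ).2 _ _ hmem
  rw [inner_add_right, inner_smul_right, cosMul_zonalEmbedding, LinearIsometry.inner_map_map,
    Complex.add_re, Complex.re_ofReal_mul] at h1
  have h2 : ‖zonalEmbedding hn D‖ ^ 2 = ∑ ℓ ∈ s, ‖d ℓ‖ ^ 2 := by
    rw [← re_inner_self, hU, ho.inner_sum, Complex.re_sum]
    refine Finset.sum_congr rfl fun ℓ _ => ?_
    rw [← Complex.normSq_eq_conj_mul_self, Complex.ofReal_re, Complex.normSq_eq_norm_sq]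
  have h3 : (inner ℂ (zonalEmbedding hn D)
      (∑ ℓ ∈ s, ((sphEigenvalue n ℓ : ℂ) * d ℓ) • zonalUnit n ℓ)).re =
      ∑ ℓ ∈ s, sphEigenvalue n ℓ * ‖d ℓ‖ ^ 2 := by
    rw [hU, ho.inner_sum, Complex.re_sum]
    refine Finset.sum_congr rfl fun ℓ _ => ?_
    rw [mul_left_comm, ← Complex.normSq_eq_conj_mul_self, Complex.re_ofReal_mul, Complex.ofReal_re,
      Complex.normSq_eq_norm_sq]
  rwa [h2, h3] at h1

/-- The trial vector is `e₀ - ε e₁`. A suitable `ε` shows `λ < 0` for `γ > 0`, and `ε = 1` shows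
that `λ` becomes very negative for large `γ`. -/
theorem lowestEigenvalue_trial (hn : 3 ≤ n) (γ ε : ℝ) :
    lowestEigenvalue n γ * (1 + ε ^ 2) ≤ (n - 1) * ε ^ 2 - 2 * γ * jacobiCoeff n 1 * ε := by
  have h := lowestEigenvalue_mul_le hn γ {0, 1} (fun ℓ => if ℓ = 0 then 1 else ((-ε : ℝ) : ℂ))
  have h01 : (0 : ℕ) ∉ ({1} : Finset ℕ) := by simp
  rw [Finset.sum_insert h01, Finset.sum_insert h01, Finset.sum_insert h01, Finset.sum_singleton,
    Finset.sum_singleton, Finset.sum_singleton, map_add, if_pos rfl, if_neg one_ne_zero,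
    jacobiOp_single_zero, jacobiOp_single_succ] at h
  simp only [inner_add_left, lp.inner_single_left, lp.coeFn_add, lp.coeFn_smul, Pi.add_apply,
    Pi.smul_apply, coe_single, sphEigenvalue] at h
  simp at h
  nlinarith

theorem lowestEigenvalue_neg (hn : 3 ≤ n) {γ : ℝ} (hγ : 0 < γ) : lowestEigenvalue n γ < 0 := by
  have h3 : (3 : ℝ) ≤ n := by exact_mod_cast hn
  have ha := jacobiCoeff_succ_pos hn 0
  rw [zero_add] at ha
  -- This `ε` minimizes `(n-1) ε² - 2 γ a₁ ε`.
  have h := lowestEigenvalue_trial hn γ (γ * jacobiCoeff n 1 / (n - 1))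
  have hn1 : (0 : ℝ) < n - 1 := by linarith
  have e : ((n : ℝ) - 1) * (γ * jacobiCoeff n 1 / (n - 1)) ^ 2 -
      2 * γ * jacobiCoeff n 1 * (γ * jacobiCoeff n 1 / (n - 1)) =
      -((γ * jacobiCoeff n 1) ^ 2 / (n - 1)) := by
    field_simp
    ring
  rw [e] at h
  have hp : 0 < (γ * jacobiCoeff n 1) ^ 2 / (n - 1) := by positivity
  by_contra hc
  push Not at hc
  have := mul_nonneg hc (by positivity : 0 ≤ 1 + (γ * jacobiCoeff n 1 / (n - 1)) ^ 2)
  linarith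

/-- The ground state at `γ` serves as trial function at `γ'`; as `|cos θ| ≤ 1`, its energy changes
by at most `|γ' - γ| ‖f‖²`. -/
theorem lowestEigenvalue_le_add_dist (hn : 2 ≤ n) (γ γ' : ℝ) :
    lowestEigenvalue n γ' ≤ lowestEigenvalue n γ + dist γ' γ := by
  obtain ⟨f, hf0, hf⟩ := (lowestEigenvalue_spec hn γ).1
  have h1 := (lowestEigenvalue_spec hn γ').2 _ _ (mem_dipoleGraph_shift γ' hf)
  rw [inner_add_right, inner_smul_right, inner_smul_right, Complex.add_re, Complex.re_ofReal_mul,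
    Complex.re_ofReal_mul, re_inner_self] at h1
  have h2 : (γ' - γ) * (inner ℂ f (cosMul n f)).re ≤ dist γ' γ * ‖f‖ ^ 2 := by
    refine (le_abs_self _).trans ?_
    rw [abs_mul, Real.dist_eq, sq]
    gcongr
    refine (Complex.abs_re_le_norm _).trans ((norm_inner_le_norm _ _).trans ?_)
    gcongr
    exact ((cosMul n).le_opNorm _).trans (mul_le_of_le_one_left (norm_nonneg _) norm_cosMul_le)
  have hp : 0 < ‖f‖ ^ 2 := by have := norm_pos_iff.mpr hf0; positivity
  refine le_of_mul_le_mul_right ?_ hp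
  linarith

theorem continuous_lowestEigenvalue (hn : 2 ≤ n) : Continuous (lowestEigenvalue n) :=
  (LipschitzWith.of_le_add fun γ' γ => lowestEigenvalue_le_add_dist hn γ γ').continuous

theorem lowestEigenvalue_zero_nonneg (hn : 2 ≤ n) : 0 ≤ lowestEigenvalue n 0 := by
  obtain ⟨f, hf0, hf⟩ := (lowestEigenvalue_spec hn 0).1
  have h := re_inner_nonneg_of_mem_dipoleGraph_zero hn hf
  rw [inner_smul_right, Complex.re_ofReal_mul, re_inner_self] at h
  have hp : 0 < ‖f‖ ^ 2 := by have := norm_pos_iff.mpr hf0; positivity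
  exact nonneg_of_mul_nonneg_left h hp

/-- The intermediate value theorem makes the defining set nonempty. It is closed because `λ(0) ≥ 0`
allows `0 < γ` to be relaxed to `0 ≤ γ`, so it contains its infimum. -/
theorem criticalMoment_spec (hn : 3 ≤ n) :
    0 < criticalMoment n ∧
      lowestEigenvalue n (criticalMoment n) = -((n : ℝ) - 2) ^ 2 / 4 := by
  have h3 : (3 : ℝ) ≤ n := by exact_mod_cast hn
  have hn2 : 2 ≤ n := by omega
  have h0 := lowestEigenvalue_zero_nonneg hn2
  have hcont := continuous_lowestEigenvalue hn2
  have ht : -((n : ℝ) - 2) ^ 2 / 4 < 0 := by nlinarith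
  have ha := jacobiCoeff_succ_pos hn 0
  rw [zero_add] at ha
  have hS : {γ : ℝ | 0 < γ ∧ lowestEigenvalue n γ = -((n : ℝ) - 2) ^ 2 / 4} =
      {γ : ℝ | 0 ≤ γ ∧ lowestEigenvalue n γ = -((n : ℝ) - 2) ^ 2 / 4} := by
    ext γ
    refine ⟨fun h => ⟨h.1.le, h.2⟩, fun h => ⟨lt_of_le_of_ne h.1 ?_, h.2⟩⟩
    rintro rfl
    have := h.2
    linarith
  have hclosed : IsClosed {γ : ℝ | 0 < γ ∧ lowestEigenvalue n γ = -((n : ℝ) - 2) ^ 2 / 4} := by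
    rw [hS]
    exact (isClosed_le continuous_const continuous_id).inter
      (isClosed_eq hcont continuous_const)
  have hne : {γ : ℝ | 0 < γ ∧ lowestEigenvalue n γ = -((n : ℝ) - 2) ^ 2 / 4}.Nonempty := by
    -- With `ε = 1` this choice gives `2 λ ≤ n - 1 - 2 n²`, well below the critical level.
    set Γ := ((n : ℝ) ^ 2) / jacobiCoeff n 1 with hΓ
    have hΓ0 : 0 ≤ Γ := by positivity
    have h1 := lowestEigenvalue_trial hn Γ 1
    have h2 : Γ * jacobiCoeff n 1 = (n : ℝ) ^ 2 := by rw [hΓ]; field_simp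
    have h4 : lowestEigenvalue n Γ ≤ -((n : ℝ) - 2) ^ 2 / 4 := by nlinarith
    obtain ⟨γ, hγ, hγ'⟩ := intermediate_value_Icc' hΓ0 hcont.continuousOn
      ⟨h4, ht.le.trans h0⟩
    rw [hS]
    exact ⟨γ, hγ.1, hγ'⟩
  exact hclosed.csInf_mem hne ⟨0, fun γ hγ => hγ.1.le⟩

end Critical

/-! ### Diagonal operators and shifts -/

theorem norm_diagOp_le {c : ℕ → ℝ} (hc : ∃ C, ∀ ℓ, |c ℓ| ≤ C) {C : ℝ} (hC0 : 0 ≤ C)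
    (hC : ∀ ℓ, |c ℓ| ≤ C) : ‖diagOp c hc‖ ≤ C := by
  refine ContinuousLinearMap.opNorm_le_bound _ hC0 fun x => ?_
  refine le_of_sq_le_sq ?_ (by positivity)
  rw [norm_sq_eq, mul_pow, norm_sq_eq x, ← tsum_mul_left]
  refine Summable.tsum_le_tsum (fun ℓ => ?_) (summable_diag hC x)
    ((summable_sq x).mul_left (C ^ 2))
  rw [diagOp_apply, norm_mul, mul_pow, Complex.norm_real, Real.norm_eq_abs]
  gcongr
  exact hC ℓ

theorem norm_leftShift_le : ‖leftShift‖ ≤ 1 := by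
  refine ContinuousLinearMap.opNorm_le_bound _ zero_le_one fun x => ?_
  refine le_of_sq_le_sq ?_ (by positivity)
  rw [one_mul, norm_sq_eq, norm_sq_eq x, (summable_sq x).tsum_eq_zero_add]
  exact le_add_of_nonneg_left (by positivity)

theorem norm_rightShift_le : ‖rightShift‖ ≤ 1 := by
  refine ContinuousLinearMap.opNorm_le_bound _ zero_le_one fun x => ?_
  refine le_of_sq_le_sq ?_ (by positivity)
  rw [one_mul, norm_sq_eq, norm_sq_eq x, (summable_sq (rightShift x)).tsum_eq_zero_add,
    rightShift_apply_zero]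
  simp only [rightShift_apply_succ, norm_zero, ne_eq, OfNat.ofNat_ne_zero, not_false_eq_true,
    zero_pow, zero_add, le_refl]

theorem inner_diagOp_left {c : ℕ → ℝ} (hc : ∃ C, ∀ ℓ, |c ℓ| ≤ C) (x y : EllTwo) :
    inner ℂ (diagOp c hc x) y = inner ℂ x (diagOp c hc y) := by
  rw [lp.inner_eq_tsum, lp.inner_eq_tsum]
  refine tsum_congr fun ℓ => ?_
  rw [diagOp_apply, diagOp_apply, RCLike.inner_apply, RCLike.inner_apply, map_mul,
    Complex.conj_ofReal]
  ring

theorem diagOp_single {c : ℕ → ℝ} (hc : ∃ C, ∀ ℓ, |c ℓ| ≤ C) (ℓ : ℕ) (z : ℂ) :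
    diagOp c hc (lp.single 2 ℓ z) = lp.single 2 ℓ ((c ℓ : ℂ) * z) := by
  ext m
  rw [diagOp_apply, coe_single, coe_single]
  by_cases h : m = ℓ
  · subst h; simp
  · simp [h]

/-- The truncations to the first `N` entries have finite rank and converge in norm. -/
theorem isCompactOperator_diagOp {c : ℕ → ℝ} (hc : ∃ C, ∀ ℓ, |c ℓ| ≤ C)
    (h0 : Filter.Tendsto c Filter.atTop (nhds 0)) : IsCompactOperator (diagOp c hc) := by
  have hb (N : ℕ) : ∃ C, ∀ ℓ, |if ℓ < N then c ℓ else 0| ≤ C := by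
    obtain ⟨C, hC⟩ := hc
    refine ⟨C, fun ℓ => ?_⟩
    split_ifs
    · exact hC ℓ
    · rw [abs_zero]; exact (abs_nonneg _).trans (hC 0)
  refine isCompactOperator_of_tendsto (l := Filter.atTop)
    (F := fun N : ℕ => diagOp (fun ℓ => if ℓ < N then c ℓ else 0) (hb N)) ?_
    (Filter.Eventually.of_forall fun N => ?_)
  · rw [Metric.tendsto_atTop]
    intro ε hε
    obtain ⟨N, hN⟩ := Metric.tendsto_atTop.1 h0 (ε / 2) (by positivity)
    refine ⟨N, fun M hM => ?_⟩
    have hd : ∀ ℓ, |(if ℓ < M then c ℓ else 0) - c ℓ| ≤ ε / 2 := fun ℓ => by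
      split_ifs with h
      · rw [sub_self, abs_zero]; positivity
      · have := hN ℓ (by omega)
        rw [Real.dist_eq, sub_zero] at this
        rw [zero_sub, abs_neg]; exact this.le
    have he : diagOp (fun ℓ => if ℓ < M then c ℓ else 0) (hb M) - diagOp c hc =
        diagOp (fun ℓ => (if ℓ < M then c ℓ else 0) - c ℓ) ⟨_, hd⟩ := by
      ext x ℓ
      change ((_ : ℝ) : ℂ) * x ℓ - (c ℓ : ℂ) * x ℓ = ((_ : ℝ) : ℂ) * x ℓ
      push_cast
      ring
    rw [dist_eq_norm, he]
    exact (norm_diagOp_le _ (by positivity) hd).trans_lt (by linarith)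
  · have : FiniteDimensional ℂ (Submodule.span ℂ
        ((fun ℓ => (lp.single 2 ℓ (1 : ℂ) : EllTwo)) '' (Finset.range N : Set ℕ))) :=
      FiniteDimensional.span_of_finite ℂ ((Finset.finite_toSet _).image _)
    refine isCompactOperator_of_finiteDimensional_range
      (Submodule.span ℂ ((fun ℓ => (lp.single 2 ℓ (1 : ℂ) : EllTwo)) '' (Finset.range N : Set ℕ)))
      fun x => ?_
    have hx : diagOp (fun ℓ => if ℓ < N then c ℓ else 0) (hb N) x =
        ∑ ℓ ∈ Finset.range N, ((c ℓ : ℂ) * x ℓ) • (lp.single 2 ℓ (1 : ℂ) : EllTwo) := by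
      ext m
      rw [diagOp_apply, lp.coeFn_sum, Finset.sum_apply]
      simp only [lp.coeFn_smul, Pi.smul_apply, coe_single]
      by_cases h : m < N
      · rw [Finset.sum_eq_single m] <;> simp +contextual [h, eq_comm]
      · rw [Finset.sum_eq_zero]
        · simp [h]
        · intro ℓ hℓ
          have : m ≠ ℓ := by rintro rfl; exact h (Finset.mem_range.1 hℓ)
          simp [this]
    rw [hx]
    exact Submodule.sum_mem _ fun ℓ hℓ => Submodule.smul_mem _ _
      (Submodule.subset_span ⟨ℓ, hℓ, rfl⟩)

/-! ### The operator `K(γ)` -/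

theorem tendsto_weight_inv_sqrt (n : ℕ) (γ : ℝ) :
    Filter.Tendsto (fun ℓ : ℕ => (√(weight n γ ℓ))⁻¹) Filter.atTop (nhds 0) := by
  refine Filter.Tendsto.inv_tendsto_atTop (Real.tendsto_sqrt_atTop.comp ?_)
  have hlin : Filter.Tendsto (fun ℓ : ℕ => (ℓ : ℝ) - lowestEigenvalue n γ)
      Filter.atTop Filter.atTop :=
    Filter.tendsto_atTop_add_const_right _ _ tendsto_natCast_atTop_atTop
  refine Filter.tendsto_atTop_mono' _ ?_ hlin
  filter_upwards [Filter.eventually_ge_atTop 3] with ℓ hℓ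
  have h3 : (3 : ℝ) ≤ ℓ := by exact_mod_cast hℓ
  have hn : (0 : ℝ) ≤ n := n.cast_nonneg
  rw [weight]
  nlinarith

theorem isCompactOperator_weightedJacobi (n : ℕ) (γ : ℝ) :
    IsCompactOperator (weightedJacobi n γ) :=
  (isCompactOperator_diagOp (weight_bounded n γ) (tendsto_weight_inv_sqrt n γ)).comp_clm
    (jacobiOp n ∘L weightInvSqrt n γ)

/-! ### Symmetry and the lower bound for `γ K(γ)` -/

theorem inner_jacobiOp_left {n : ℕ} (hn : 3 ≤ n) (x y : EllTwo) :
    inner ℂ (jacobiOp n x) y = inner ℂ x (jacobiOp n y) := by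
  rw [← (zonalEmbedding hn).inner_map_map, ← cosMul_zonalEmbedding,
    ← (zonalEmbedding hn).inner_map_map x, ← cosMul_zonalEmbedding]
  exact isSymmetric_cosMul _ _

theorem inner_weightedJacobi_left {n : ℕ} (hn : 3 ≤ n) (γ : ℝ) (x y : EllTwo) :
    inner ℂ (weightedJacobi n γ x) y = inner ℂ x (weightedJacobi n γ y) := by
  change inner ℂ (weightInvSqrt n γ (jacobiOp n (weightInvSqrt n γ x))) y =
    inner ℂ x (weightInvSqrt n γ (jacobiOp n (weightInvSqrt n γ y)))
  rw [weightInvSqrt, inner_diagOp_left, inner_jacobiOp_left hn, inner_diagOp_left]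

theorem weight_pos {n : ℕ} (hn : 3 ≤ n) {γ : ℝ} (hγ : 0 < γ) (ℓ : ℕ) : 0 < weight n γ ℓ := by
  have h := lowestEigenvalue_neg hn hγ
  have hn' : (3 : ℝ) ≤ n := by exact_mod_cast hn
  have : (0 : ℝ) ≤ ℓ * (ℓ + n - 2) := mul_nonneg ℓ.cast_nonneg (by
    have : (0 : ℝ) ≤ ℓ := ℓ.cast_nonneg
    linarith)
  rw [weight]
  linarith

theorem norm_sq_sum_single (s : Finset ℕ) (x : ℕ → ℂ) :
    ‖∑ ℓ ∈ s, (lp.single 2 ℓ (x ℓ) : EllTwo)‖ ^ 2 = ∑ ℓ ∈ s, ‖x ℓ‖ ^ 2 := by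
  have h := lp.norm_sum_single (p := 2) (E := fun _ : ℕ => ℂ) (by norm_num) x s
  simpa using h

/-- The substitution `d = w^{-1/2} x` in the variational inequality: `w_ℓ |d_ℓ|² = |x_ℓ|²` absorbs
both the Laplacian and `λ`. -/
theorem inner_weightedJacobi_finite {n : ℕ} (hn : 3 ≤ n) {γ : ℝ} (hγ : 0 < γ) (s : Finset ℕ)
    (x : ℕ → ℂ) :
    0 ≤ γ * (inner ℂ (∑ ℓ ∈ s, (lp.single 2 ℓ (x ℓ) : EllTwo))
        (weightedJacobi n γ (∑ ℓ ∈ s, lp.single 2 ℓ (x ℓ)))).re +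
      ‖∑ ℓ ∈ s, (lp.single 2 ℓ (x ℓ) : EllTwo)‖ ^ 2 := by
  have h := lowestEigenvalue_mul_le hn γ s fun ℓ => (((√(weight n γ ℓ))⁻¹ : ℝ) : ℂ) * x ℓ
  have hD : weightInvSqrt n γ (∑ ℓ ∈ s, lp.single 2 ℓ (x ℓ)) =
      ∑ ℓ ∈ s, lp.single 2 ℓ ((((√(weight n γ ℓ))⁻¹ : ℝ) : ℂ) * x ℓ) := by
    rw [map_sum]
    exact Finset.sum_congr rfl fun ℓ _ => diagOp_single _ _ _
  have hK : inner ℂ (∑ ℓ ∈ s, (lp.single 2 ℓ (x ℓ) : EllTwo))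
      (weightedJacobi n γ (∑ ℓ ∈ s, lp.single 2 ℓ (x ℓ))) =
      inner ℂ (weightInvSqrt n γ (∑ ℓ ∈ s, lp.single 2 ℓ (x ℓ)))
        (jacobiOp n (weightInvSqrt n γ (∑ ℓ ∈ s, lp.single 2 ℓ (x ℓ)))) :=
    (inner_diagOp_left _ _ _).symm
  rw [hK, hD, norm_sq_sum_single]
  have hsum : ∑ ℓ ∈ s, ‖x ℓ‖ ^ 2 =
      ∑ ℓ ∈ s, sphEigenvalue n ℓ * ‖(((√(weight n γ ℓ))⁻¹ : ℝ) : ℂ) * x ℓ‖ ^ 2 -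
        lowestEigenvalue n γ * ∑ ℓ ∈ s, ‖(((√(weight n γ ℓ))⁻¹ : ℝ) : ℂ) * x ℓ‖ ^ 2 := by
    rw [Finset.mul_sum, ← Finset.sum_sub_distrib]
    refine Finset.sum_congr rfl fun ℓ _ => ?_
    have hw := weight_pos hn hγ ℓ
    rw [norm_mul, Complex.norm_real, Real.norm_eq_abs, mul_pow, sq_abs, inv_pow,
      Real.sq_sqrt hw.le, ← sub_mul]
    change _ = weight n γ ℓ * _
    rw [mul_inv_cancel_left₀ hw.ne']
  rw [hsum]
  linarith

theorem neg_id_le_weightedJacobi {n : ℕ} (hn : 3 ≤ n) {γ : ℝ} (hγ : 0 < γ) :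
    -ContinuousLinearMap.id ℂ EllTwo ≤ (γ : ℂ) • weightedJacobi n γ := by
  rw [ContinuousLinearMap.le_def, ContinuousLinearMap.isPositive_def, sub_neg_eq_add]
  refine ⟨fun x y => ?_, fun x => ?_⟩
  · change inner ℂ ((γ : ℂ) • weightedJacobi n γ x + x) y =
      inner ℂ x ((γ : ℂ) • weightedJacobi n γ y + y)
    rw [inner_add_left, inner_add_right, inner_smul_left, inner_smul_right,
      inner_weightedJacobi_left hn, Complex.conj_ofReal]
  · have hx : ((γ : ℂ) • weightedJacobi n γ + ContinuousLinearMap.id ℂ EllTwo).reApplyInnerSelf x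
        = γ * (inner ℂ x (weightedJacobi n γ x)).re + ‖x‖ ^ 2 := by
      rw [← re_inner_self, ← Complex.re_ofReal_mul, ← Complex.add_re, ← inner_smul_right,
        ← inner_add_right, ContinuousLinearMap.reApplyInnerSelf_apply, ← inner_re_symm]
      rfl
    rw [hx]
    have hcont : Continuous fun z : EllTwo =>
        γ * (inner ℂ z (weightedJacobi n γ z)).re + ‖z‖ ^ 2 := by fun_prop
    -- Finite truncations converge to `x`, and the form is continuous because `K` is bounded.
    have hs : HasSum (fun ℓ => (lp.single 2 ℓ (x ℓ) : EllTwo)) x :=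
      lp.hasSum_single (by norm_num) x
    exact ge_of_tendsto ((hcont.tendsto x).comp hs)
      (Filter.Eventually.of_forall fun s => inner_weightedJacobi_finite hn hγ s x)

/-! ### The norm of `K(γ)` through its off-diagonal entries -/

theorem jacobiCoeffTilde_nonneg (n : ℕ) (γ : ℝ) (ℓ : ℕ) : 0 ≤ jacobiCoeffTilde n γ ℓ := by
  rw [jacobiCoeffTilde, jacobiCoeff]
  positivity

/-- `K` is again a Jacobi matrix, with entries `ã_ℓ`: it is `D L + R D` with contractive shifts, and
each summand has norm at most `M`. -/
theorem norm_weightedJacobi_le {n : ℕ} {γ M : ℝ}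
    (hM : ∀ ℓ : ℕ, jacobiCoeffTilde n γ (ℓ + 1) ≤ M) : ‖weightedJacobi n γ‖ ≤ 2 * M := by
  have hM' (ℓ : ℕ) : |jacobiCoeffTilde n γ (ℓ + 1)| ≤ M := by
    rw [abs_of_nonneg (jacobiCoeffTilde_nonneg n γ _)]; exact hM ℓ
  have hM0 : 0 ≤ M := (jacobiCoeffTilde_nonneg n γ _).trans (hM 0)
  have hw (ℓ : ℕ) : weight n γ (((ℓ + 1 : ℕ) : ℝ) - 1) = weight n γ ℓ := by
    rw [Nat.cast_add_one, add_sub_cancel_right]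
  have hK : weightedJacobi n γ =
      diagOp (fun ℓ => jacobiCoeffTilde n γ (ℓ + 1)) ⟨M, hM'⟩ ∘L leftShift +
        rightShift ∘L diagOp (fun ℓ => jacobiCoeffTilde n γ (ℓ + 1)) ⟨M, hM'⟩ := by
    ext x ℓ
    change weightInvSqrt n γ (jacobiOp n (weightInvSqrt n γ x)) ℓ =
      diagOp _ ⟨M, hM'⟩ (leftShift x) ℓ + rightShift (diagOp _ ⟨M, hM'⟩ x) ℓ
    rw [weightInvSqrt, diagOp_apply, diagOp_apply, leftShift_apply]
    cases ℓ with
    | zero =>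
      rw [jacobiOp_apply_zero, rightShift_apply_zero, diagOp_apply, jacobiCoeffTilde, hw]
      push_cast
      ring
    | succ ℓ =>
      rw [jacobiOp_apply_succ, rightShift_apply_succ, diagOp_apply, diagOp_apply, diagOp_apply,
        jacobiCoeffTilde, jacobiCoeffTilde, hw, hw]
      push_cast
      ring_nf
  rw [hK]
  refine (norm_add_le _ _).trans ?_
  have h1 := (ContinuousLinearMap.opNorm_comp_le
    (diagOp (fun ℓ => jacobiCoeffTilde n γ (ℓ + 1)) ⟨M, hM'⟩) leftShift).trans
    (mul_le_mul (norm_diagOp_le _ hM0 hM') norm_leftShift_le (norm_nonneg _) hM0)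
  have h2 := (ContinuousLinearMap.opNorm_comp_le rightShift
    (diagOp (fun ℓ => jacobiCoeffTilde n γ (ℓ + 1)) ⟨M, hM'⟩)).trans
    (mul_le_mul norm_rightShift_le (norm_diagOp_le _ hM0 hM') (norm_nonneg _) zero_le_one)
  linarith

/-! ### The coefficients at the critical moment -/

/-- `ℓ(ℓ+n-3)`, the variable in which `ã_ℓ(γ_{c,n})²` is a rational function. -/
def shiftedEigenvalue (n ℓ : ℕ) : ℝ := (ℓ : ℝ) * (ℓ + n - 3)

/-- The critical value `-(n-2)²/4` is the one that completes the square. -/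
theorem weight_criticalMoment {n : ℕ} (hn : 3 ≤ n) (ℓ : ℝ) :
    weight n (criticalMoment n) ℓ = (ℓ + ((n : ℝ) - 2) / 2) ^ 2 := by
  rw [weight, (criticalMoment_spec hn).2]
  ring

/-- Every factor depends on `u = ℓ(ℓ+n-3)` alone, because `(2ℓ+n-4)(2ℓ+n-2) = 4u + (n-4)(n-2)`; the
weights contribute the square of this product. -/
theorem jacobiCoeffTilde_criticalMoment_sq {n : ℕ} (hn : 3 ≤ n) {ℓ : ℕ} (hℓ : 1 ≤ ℓ) :
    jacobiCoeffTilde n (criticalMoment n) ℓ ^ 2 =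
      16 * shiftedEigenvalue n ℓ / (4 * shiftedEigenvalue n ℓ + (n - 4) * (n - 2)) ^ 3 := by
  obtain ⟨m, rfl⟩ : ∃ m, ℓ = m + 1 := ⟨ℓ - 1, by omega⟩
  have hn' : (3 : ℝ) ≤ n := by exact_mod_cast hn
  have hm : (0 : ℝ) ≤ m := m.cast_nonneg
  have e1 : (4 : ℝ) * shiftedEigenvalue n (m + 1) + (n - 4) * (n - 2) =
      (2 * m + n - 2) * (2 * m + n) := by
    rw [shiftedEigenvalue]; push_cast; ring
  have h1 : (0 : ℝ) < 2 * m + n - 2 := by linarith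
  have h2 : (0 : ℝ) < 2 * m + n := by linarith
  have h3 : (0 : ℝ) < m + 1 + (n - 2) / 2 := by linarith
  have h4 : (0 : ℝ) < m + (n - 2) / 2 := by linarith
  rw [e1, jacobiCoeffTilde, mul_pow, mul_pow, jacobiCoeff_succ_sq hn, weight_criticalMoment hn,
    weight_criticalMoment hn, inv_pow, inv_pow, Real.sq_sqrt (sq_nonneg _),
    Real.sq_sqrt (sq_nonneg _), shiftedEigenvalue]
  push_cast
  rw [add_sub_cancel_right]
  have e3 : (m : ℝ) + 1 + (n - 2) / 2 = (2 * m + n) / 2 := by ring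
  have e4 : (m : ℝ) + (n - 2) / 2 = (2 * m + n - 2) / 2 := by ring
  rw [e3, e4]
  field_simp
  ring

theorem one_le_shiftedEigenvalue {n : ℕ} (hn : 3 ≤ n) {ℓ : ℕ} (hℓ : 1 ≤ ℓ) :
    1 ≤ shiftedEigenvalue n ℓ := by
  have hn' : (3 : ℝ) ≤ n := by exact_mod_cast hn
  have hm : (1 : ℝ) ≤ ℓ := by exact_mod_cast hℓ
  rw [shiftedEigenvalue]
  nlinarith

theorem shiftedEigenvalue_mono {n : ℕ} (hn : 3 ≤ n) {k ℓ : ℕ} (h : k ≤ ℓ) :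
    shiftedEigenvalue n k ≤ shiftedEigenvalue n ℓ := by
  have hn' : (3 : ℝ) ≤ n := by exact_mod_cast hn
  have hk : (k : ℝ) ≤ ℓ := by exact_mod_cast h
  have h0 : (0 : ℝ) ≤ k := k.cast_nonneg
  rw [shiftedEigenvalue, shiftedEigenvalue]
  exact mul_le_mul hk (by linarith) (by linarith) (by linarith)

/-- `u ↦ u / (4u + c)³` decreases for `u ≥ c / 8`. -/
theorem div_cube_anti {c u v : ℝ} (hc : 0 ≤ c) (hu0 : 0 < u) (hu : c / 8 ≤ u) (huv : u ≤ v) :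
    16 * v / (4 * v + c) ^ 3 ≤ 16 * u / (4 * u + c) ^ 3 := by
  have hv0 : 0 < v := hu0.trans_le huv
  rw [div_le_div_iff₀ (by positivity) (by positivity)]
  have h1 : (c / 8) * (c / 8) ≤ u * v := mul_le_mul hu (hu.trans huv) (by positivity) hu0.le
  have h2 : c / 4 ≤ u + v := by linarith
  have h3 : (c / 8) * (c / 8) * (c / 4) ≤ u * v * (u + v) :=
    mul_le_mul h1 h2 (by positivity) (by positivity)
  have h4 : (c / 8) * (c / 8) * c ≤ u * v * c := mul_le_mul_of_nonneg_right h1 hc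
  -- The difference of the cross-multiplied sides is 16 times this product; its second factor
  -- vanishes at `u = v = c/8`.
  have h5 : 0 ≤ (v - u) * (64 * (u * v * (u + v)) + 48 * (u * v * c) - c ^ 3) :=
    mul_nonneg (by linarith) (by linarith)
  linarith

/-- `u ↦ u / (4u + c)³` increases for `u ≤ c / 8`. -/
theorem div_cube_mono {c u v : ℝ} (hc : 0 ≤ c) (hu0 : 0 < u) (huv : u ≤ v) (hv : v ≤ c / 8) :
    16 * u / (4 * u + c) ^ 3 ≤ 16 * v / (4 * v + c) ^ 3 := by
  have hv0 : 0 < v := hu0.trans_le huv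
  rw [div_le_div_iff₀ (by positivity) (by positivity)]
  have h1 : u * v ≤ (c / 8) * (c / 8) := mul_le_mul (huv.trans hv) hv hv0.le (by positivity)
  have h2 : u + v ≤ c / 4 := by linarith
  have h3 : u * v * (u + v) ≤ (c / 8) * (c / 8) * (c / 4) :=
    mul_le_mul h1 h2 (by positivity) (by positivity)
  have h4 : u * v * c ≤ (c / 8) * (c / 8) * c := mul_le_mul_of_nonneg_right h1 hc
  have h5 : 0 ≤ (v - u) * (c ^ 3 - 64 * (u * v * (u + v)) - 48 * (u * v * c)) :=
    mul_nonneg (by linarith) (by linarith)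
  linarith

theorem jacobiCoeffTilde_anti {n : ℕ} (hn : 4 ≤ n) {k ℓ : ℕ} (hk : 1 ≤ k) (hkℓ : k ≤ ℓ)
    (h : ((n : ℝ) - 4) * (n - 2) / 8 ≤ shiftedEigenvalue n k) :
    jacobiCoeffTilde n (criticalMoment n) ℓ ≤ jacobiCoeffTilde n (criticalMoment n) k := by
  have hn' : (4 : ℝ) ≤ n := by exact_mod_cast hn
  refine le_of_sq_le_sq ?_ (jacobiCoeffTilde_nonneg _ _ _)
  rw [jacobiCoeffTilde_criticalMoment_sq (by omega) hk,
    jacobiCoeffTilde_criticalMoment_sq (by omega) (hk.trans hkℓ)]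
  exact div_cube_anti (mul_nonneg (by linarith) (by linarith))
    (zero_lt_one.trans_le (one_le_shiftedEigenvalue (by omega) hk)) h
    (shiftedEigenvalue_mono (by omega) hkℓ)

theorem jacobiCoeffTilde_mono {n : ℕ} (hn : 4 ≤ n) {k ℓ : ℕ} (hk : 1 ≤ k) (hkℓ : k ≤ ℓ)
    (h : shiftedEigenvalue n ℓ ≤ ((n : ℝ) - 4) * (n - 2) / 8) :
    jacobiCoeffTilde n (criticalMoment n) k ≤ jacobiCoeffTilde n (criticalMoment n) ℓ := by
  have hn' : (4 : ℝ) ≤ n := by exact_mod_cast hn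
  refine le_of_sq_le_sq ?_ (jacobiCoeffTilde_nonneg _ _ _)
  rw [jacobiCoeffTilde_criticalMoment_sq (by omega) hk,
    jacobiCoeffTilde_criticalMoment_sq (by omega) (hk.trans hkℓ)]
  exact div_cube_mono (mul_nonneg (by linarith) (by linarith))
    (zero_lt_one.trans_le (one_le_shiftedEigenvalue (by omega) hk))
    (shiftedEigenvalue_mono (by omega) hkℓ) h

/-- `rootR n` is the larger root of `ℓ(ℓ+n-3) = (n-4)(n-2)/8`, the point where `ã_ℓ²`, as a function
of real `ℓ`, is maximal. -/
theorem rootR_le_iff {n : ℕ} (hn : 5 ≤ n) (ℓ : ℕ) :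
    rootR n ≤ ℓ ↔ ((n : ℝ) - 4) * (n - 2) / 8 ≤ shiftedEigenvalue n ℓ := by
  have hn' : (5 : ℝ) ≤ n := by exact_mod_cast hn
  have hℓ : (0 : ℝ) ≤ ℓ := ℓ.cast_nonneg
  have h1 : rootR n ≤ ℓ ↔
      √(2 * (26 - 18 * (n : ℝ) + 3 * (n : ℝ) ^ 2)) ≤ 4 * ℓ + 2 * n - 6 := by
    rw [rootR]
    constructor <;> intro h <;> linarith
  rw [h1, Real.sqrt_le_left (by linarith), shiftedEigenvalue]
  constructor <;> intro h <;> linarith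

theorem one_le_indexR {n : ℕ} (hn : 5 ≤ n) : 1 ≤ indexR n := by
  have hn' : (5 : ℝ) ≤ n := by exact_mod_cast hn
  rw [indexR, Nat.one_le_ceil_iff]
  by_contra h
  have h2 := (rootR_le_iff hn 0).1 (by simpa using h)
  rw [shiftedEigenvalue, Nat.cast_zero, zero_mul] at h2
  nlinarith

/-- `indexR n` is the first integer at or beyond the maximum: the entries decrease from there on and
increase up to its predecessor. -/
theorem jacobiCoeffTilde_succ_le_max {n : ℕ} (hn : 5 ≤ n) (m : ℕ) :
    jacobiCoeffTilde n (criticalMoment n) (m + 1) ≤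
      max (jacobiCoeffTilde n (criticalMoment n) (indexR n))
        (jacobiCoeffTilde n (criticalMoment n) (indexR n - 1)) := by
  have hL := one_le_indexR hn
  rcases le_or_gt (indexR n) (m + 1) with h | h
  · exact le_max_of_le_left (jacobiCoeffTilde_anti (by omega) hL h
      ((rootR_le_iff hn _).1 (Nat.le_ceil _)))
  -- Here `1 ≤ m + 1 ≤ indexR n - 1`, so the truncated subtraction is genuine.
  · refine le_max_of_le_right (jacobiCoeffTilde_mono (by omega) (by omega) (by omega) ?_)
    have h1 : ¬ rootR n ≤ (indexR n - 1 : ℕ) := fun h2 => by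
      have := Nat.ceil_le.2 h2
      rw [← indexR] at this
      omega
    rw [rootR_le_iff hn] at h1
    exact (not_le.1 h1).le

/-- For `n = 3` the constant `c = -1` is negative and the monotonicity lemmas do not apply. Instead
`(4u-1)³ - 27u = (u-1)(64u²+16u+1) ≥ 0` for `u ≥ 1`, with equality at `ℓ = 1`. -/
theorem jacobiCoeffTilde_three_le (m : ℕ) :
    jacobiCoeffTilde 3 (criticalMoment 3) (m + 1) ≤ 4 / (3 : ℝ) ^ (3 / 2 : ℝ) := by
  refine le_of_sq_le_sq ?_ (by positivity)
  have h3 : ((3 : ℝ) ^ (3 / 2 : ℝ)) ^ 2 = 27 := by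
    rw [← Real.rpow_natCast, ← Real.rpow_mul (by norm_num)]
    norm_num
  rw [jacobiCoeffTilde_criticalMoment_sq le_rfl (by omega), div_pow, h3]
  have hu := one_le_shiftedEigenvalue le_rfl (show 1 ≤ m + 1 by omega)
  generalize shiftedEigenvalue 3 (m + 1) = u at hu ⊢
  push_cast
  have hp : 0 < (4 * u + (3 - 4) * (3 - 2)) ^ 3 := by
    apply pow_pos; linarith
  rw [div_le_div_iff₀ hp (by norm_num)]
  have h4 : 0 ≤ (u - 1) * (64 * u ^ 2 + 16 * u + 1) := mul_nonneg (by linarith) (by positivity)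
  linarith

end Dipole

end

theorem proposition4p1 (n : ℕ) (hn : 3 ≤ n) :
    (∀ γ ∈ Set.Ioc 0 (Dipole.criticalMoment n),
      IsCompactOperator (Dipole.weightedJacobi n γ)) ∧
    (∀ γ ∈ Set.Ioc 0 (Dipole.criticalMoment n),
      -ContinuousLinearMap.id ℂ Dipole.EllTwo ≤ (γ : ℂ) • Dipole.weightedJacobi n γ) ∧
    (n = 3 →
      ‖Dipole.weightedJacobi n (Dipole.criticalMoment n)‖ ≤ 8 / (3 : ℝ) ^ (3 / 2 : ℝ)) ∧
    (n = 4 →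
      ‖Dipole.weightedJacobi n (Dipole.criticalMoment n)‖ ≤
        2 * Dipole.jacobiCoeffTilde n (Dipole.criticalMoment n) 1) ∧
    (5 ≤ n →
      ‖Dipole.weightedJacobi n (Dipole.criticalMoment n)‖ ≤
        2 * max (Dipole.jacobiCoeffTilde n (Dipole.criticalMoment n) (Dipole.indexR n))
          (Dipole.jacobiCoeffTilde n (Dipole.criticalMoment n) (Dipole.indexR n - 1))) := by
  refine ⟨fun γ _ => Dipole.isCompactOperator_weightedJacobi n γ,
    fun γ hγ => Dipole.neg_id_le_weightedJacobi hn hγ.1, ?_, ?_, fun h5 => ?_⟩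
  · rintro rfl
    refine (Dipole.norm_weightedJacobi_le Dipole.jacobiCoeffTilde_three_le).trans_eq ?_
    ring
  · rintro rfl
    refine Dipole.norm_weightedJacobi_le fun ℓ =>
      Dipole.jacobiCoeffTilde_anti le_rfl le_rfl (by omega) ?_
    -- For `n = 4` the threshold `(n-4)(n-2)/8` is zero, so the entries decrease from `ℓ = 1` on.
    have := Dipole.one_le_shiftedEigenvalue hn (le_refl 1)
    push_cast
    linarith
  · exact Dipole.norm_weightedJacobi_le (Dipole.jacobiCoeffTilde_succ_le_max h5)
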